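/- A pizza cut into $n\ge 1$ slices is a circular sequence $P=p_0p_1\dots p_{n-1}$ of slices with sizes $|p_i|\ge 0$ (indices modulo $n$); its size is $|P|=\sum_i |p_i|$. Alice and Bob alternately take one slice per turn until all slices are taken. Alice moves first and may take any slice; in every later turn a player may take any remaining slice adjacent to some previously taken slice. A turn other than the first is a *shift* if the slice taken is adjacent to the slice taken in the immediately preceding turn, and a *jump* otherwise. A strategy of Alice has *gain* $c$ on $P$ if, whatever Bob does, the slices she takes have total size at least $c$; it is a *$j$-jump strategy* if, whatever Bob does, she makes at most $j$ jumps. **Theorem.** For $n\ge 1$, let $g(n)$ be the maximum $g\in[0,1]$ such that for any cutting $P$ of the pizza into $n$ slices, Alice has a strategy with gain $g|P|$. This maximum exists and $$g(n)=\begin{cases}1 & \text{if } n=1,\\ 4/9 & \text{if } n\in\{15,17,19,\dots\},\\ 1/2 & \text{otherwise.}\end{cases}$$ Moreover, on every cutting $P$ into $n$ slices, Alice has a zero-jump strategy with gain $g(n)|P|$ when $n$ is even or $n\le 7$, a one-jump strategy with gain $g(n)|P|$ when $n\in\{9,11,13\}$, and a two-jump strategy with gain $g(n)|P|$ when $n\in\{15,17,19,\dots\}$.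 The following cuttings attain the upper bounds. For odd $n\ge 15$, Alice has no strategy with gain greater than $\frac49|P|$ on the cutting $P$ with consecutive slice sizes $0,0,2,0,2,0,0,3,0,3,0,0,4,0,4$ followed by $n-15$ zeros. For every $n\ge 2$, Alice has no strategy with gain greater than $\frac12|P|$ on the cutting $P$ with consecutive slice sizes $1,1$ followed by $n-2$ zeros. -/

import Mathlib

/-!
The pizza game on a circular sequence of `n` slices, indexed by `ZMod n`.
A history is the list of the slices taken so far, most recent first; the turn made at a history `h`
is Alice's exactly when `h.length` is even.
-/

namespace Pizza

/-- The slices `a` and `b` are neighbours on the circle. -/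
def Adjacent {n : ℕ} (a b : ZMod n) : Prop := b = a + 1 ∨ b = a - 1

instance {n : ℕ} (a b : ZMod n) : Decidable (Adjacent a b) :=
  inferInstanceAs (Decidable (b = a + 1 ∨ b = a - 1))

/-- The slice `s` may be taken at the history `h`: it is not yet taken, and it is adjacent to a taken
slice, unless it is taken in the very first turn. -/
def Available {n : ℕ} (h : List (ZMod n)) (s : ZMod n) : Prop :=
  s ∉ h ∧ (h = [] ∨ ∃ a ∈ h, Adjacent a s)

/-- The histories that arise by legal turns of both players. -/
inductive Legal {n : ℕ} : List (ZMod n) → Prop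
  | nil : Legal []
  | cons {h : List (ZMod n)} {s : ZMod n} : Legal h → Available h s → Legal (s :: h)

/-- A strategy of Alice: a legal turn at each legal, unfinished history at which she is to move. -/
structure AliceStrategy (n : ℕ) where
  /-- The slice taken by Alice at a given history. -/
  move : List (ZMod n) → ZMod n
  legal : ∀ h, Legal h → Even h.length → h.length < n → Available h (move h)

/-- All turns of Alice in the history are those prescribed by `σ`. -/
def Follows {n : ℕ} (σ : AliceStrategy n) : List (ZMod n) → Prop
  | [] => True
  | s :: h => (Even h.length → s = σ.move h) ∧ Follows σ h

/-- A complete game in which Alice plays according to `σ`, against arbitrary legal turns of Bob. -/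
def IsPlay {n : ℕ} (σ : AliceStrategy n) (h : List (ZMod n)) : Prop :=
  Legal h ∧ h.length = n ∧ Follows σ h

/-- The sum of the sizes of the slices taken by Alice. -/
def aliceGain {n : ℕ} (p : ZMod n → ℝ) : List (ZMod n) → ℝ
  | [] => 0
  | s :: h => (if Even h.length then p s else 0) + aliceGain p h

/-- The number of jumps made by Alice: her turns, other than the first turn of the game, on a slice
that is not adjacent to the slice taken in the immediately preceding turn. -/
def aliceJumps {n : ℕ} : List (ZMod n) → ℕ
  | [] => 0
  | [_] => 0
  | s :: r :: h =>
      (if Even (r :: h).length ∧ ¬ Adjacent r s then 1 else 0) + aliceJumps (r :: h)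

/-- `σ` is a strategy with gain `c` on the pizza with slice sizes `p`. -/
def HasGain {n : ℕ} (σ : AliceStrategy n) (p : ZMod n → ℝ) (c : ℝ) : Prop :=
  ∀ h, IsPlay σ h → c ≤ aliceGain p h

/-- `σ` is a `j`-jump strategy: Alice makes at most `j` jumps in every game in which she uses it. -/
def IsJumpStrategy {n : ℕ} (j : ℕ) (σ : AliceStrategy n) : Prop :=
  ∀ h, IsPlay σ h → aliceJumps h ≤ j

/-- The size of the whole pizza. -/
def size {n : ℕ} [NeZero n] (p : ZMod n → ℝ) : ℝ := ∑ i, p i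

/-- The fractions `g ∈ [0, 1]` that Alice can guarantee on every cutting into `n` slices. -/
def guaranteedFractions (n : ℕ) [NeZero n] : Set ℝ :=
  {g | g ∈ Set.Icc (0 : ℝ) 1 ∧ ∀ p : ZMod n → ℝ, (∀ i, 0 ≤ p i) →
    ∃ σ : AliceStrategy n, HasGain σ p (g * size p)}

/-- `g(n)`, the largest fraction that Alice can guarantee on every cutting into `n` slices. -/
noncomputable def g (n : ℕ) [NeZero n] : ℝ := sSup (guaranteedFractions n)

/-- The cutting into `n` slices whose consecutive sizes are the entries of `L` followed by zeros. -/
def cutting (n : ℕ) (L : List ℝ) : ZMod n → ℝ := fun i => L.getD i.val 0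

end Pizza

/-! For even `n`, Alice starts in the heavier of the two alternating classes; by shifting she stays
in it.

For odd `n = 2 M - 1`, reorder the slices in steps of two around the pizza (the characteristic
cycle). A game of shifts from slice `v` ends with Alice holding a half-circle (`M` consecutive
slices of this cycle) through `v`, and Bob decides which. Shifts alone thus secure the potential
`p`, the maximum over `v` of the smallest half-circle through `v`. Let `T` be the total size. If `p
< T / 2`, the half-circles of size at most `p` cover the cycle, and three of them suffice; take such
a triple of minimal total (`MinTriple`). No two of the three cover, so the cycle splits into six
nonempty arcs, alternately covered once and twice, and each overlap has one slice more than the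
once-covered arc opposite to it. This needs at least 3 + 6 = 9 slices. An overlap of two slices lets
Alice get `T / 2` with one jump, so a failure with one jump needs 6 + 9 = 15 slices.

In general, let `A` and `a` be the sizes of a once-covered arc and of the opposite overlap, and `h`,
`h'` the sizes of the two overlapping half-circles. By minimality, a return to the overlap ends in a
half-circle of size at least `min h h'` (`MinTriple.le_half`), and at most two jumps secure `min h
h' + A/2 - 3a/4 = T/2 - |h - h'|/2 - a/4` (`IsPrefixSum.secures_two_jumps`). A weighted average of
two of these bounds and `p` is at least `4/9 T`.

For the upper bounds, when an even number of slices remains on his turn, Bob can confine Alice to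
either parity class. On the hard cutting, of size 18, this leaves her at most 8 unless she starts at
4, 7 or 14. After these starts Alice has to take zeros until Bob can win positive slices before
fixing the parity (`restricts_hardSize`). On `1, 1, 0, …` Bob secures one of the two ones. -/

namespace Pizza

variable {n : ℕ}

/-! ### Histories as arcs, and strategies from forced outcomes -/

/-- Alice can force the final history to satisfy `Q` when `m` turns remain after the history `h`. -/
def AliceForces (Q : List (ZMod n) → Prop) : ℕ → List (ZMod n) → Prop
  | 0, h => Q h
  | m + 1, h =>
      if Even h.length then ∃ s, Available h s ∧ AliceForces Q m (s :: h)
      else ∀ s, Available h s → AliceForces Q m (s :: h)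

/-- Bob can force the final history to satisfy `Q` when `m` turns remain after the history `h`. -/
def BobForces (Q : List (ZMod n) → Prop) : ℕ → List (ZMod n) → Prop
  | 0, h => Q h
  | m + 1, h =>
      if Even h.length then ∀ s, Available h s → BobForces Q m (s :: h)
      else ∃ s, Available h s ∧ BobForces Q m (s :: h)

/-- The slices of the history `h` are those with indices in the integer interval `[lo, hi)`. -/
structure IsArc (h : List (ZMod n)) (lo hi : ℤ) : Prop where
  length_eq : hi - lo = h.length
  length_pos : 0 < h.length
  length_le : h.length ≤ n
  mem_iff : ∀ s, s ∈ h ↔ ∃ i : ℤ, lo ≤ i ∧ i < hi ∧ s = (i : ZMod n)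

theorem isArc_singleton [NeZero n] (v : ℤ) : IsArc [(v : ZMod n)] v (v + 1) where
  length_eq := by simp
  length_pos := by simp
  length_le := by simpa using Nat.one_le_iff_ne_zero.2 (NeZero.ne n)
  mem_iff s := by
    rw [List.mem_singleton]
    constructor
    · rintro rfl
      exact ⟨v, le_rfl, by omega, rfl⟩
    · rintro ⟨i, h1, h2, rfl⟩
      obtain rfl : i = v := by omega
      rfl

theorem IsArc.available_iff {h : List (ZMod n)} {lo hi : ℤ} (ha : IsArc h lo hi)
    (hn : h.length < n) (s : ZMod n) :
    Available h s ↔ s = ((lo - 1 : ℤ) : ZMod n) ∨ s = (hi : ZMod n) := by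
  have hl := ha.length_eq
  have hp := ha.length_pos
  have hne : h ≠ [] := by
    rintro rfl
    simp at hp
  -- The arc has fewer than `n` slices, so neither of its outer neighbours is congruent to an
  -- integer inside it.
  have key : ∀ j : ℤ, (j = lo - 1 ∨ j = hi) → (j : ZMod n) ∉ h := by
    intro j hj hm
    obtain ⟨i, h1, h2, h3⟩ := (ha.mem_iff _).1 hm
    rw [ZMod.intCast_eq_intCast_iff_dvd_sub] at h3
    obtain ⟨t, ht⟩ := h3
    have hn' : (h.length : ℤ) < n := by exact_mod_cast hn
    have hnp : (0 : ℤ) < n := by omega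
    rcases hj with rfl | rfl
    · have : 0 < t := by
        by_contra hc
        have : (n : ℤ) * t ≤ 0 := mul_nonpos_of_nonneg_of_nonpos hnp.le (by omega)
        omega
      have : (n : ℤ) ≤ n * t := le_mul_of_one_le_right hnp.le this
      omega
    · have : t < 0 := by
        by_contra hc
        have : 0 ≤ (n : ℤ) * t := mul_nonneg hnp.le (by omega)
        omega
      have : (n : ℤ) * t ≤ n * (-1) := mul_le_mul_of_nonneg_left (by omega) hnp.le
      omega
  constructor
  · rintro ⟨h1, h2⟩
    obtain ⟨a, ha1, ha2⟩ := h2.resolve_left hne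
    obtain ⟨i, hi1, hi2, rfl⟩ := (ha.mem_iff _).1 ha1
    rcases ha2 with rfl | rfl
    · right
      have : ¬ i + 1 < hi := fun hc =>
        h1 ((ha.mem_iff _).2 ⟨i + 1, by omega, hc, by push_cast; rfl⟩)
      obtain rfl : hi = i + 1 := by omega
      push_cast; rfl
    · left
      have : ¬ lo ≤ i - 1 := fun hc =>
        h1 ((ha.mem_iff _).2 ⟨i - 1, hc, by omega, by push_cast; rfl⟩)
      obtain rfl : lo = i := by omega
      push_cast; rfl
  · rintro (rfl | rfl)
    · refine ⟨key _ (Or.inl rfl), Or.inr ⟨(lo : ZMod n), (ha.mem_iff _).2 ⟨lo, le_rfl, by omega, rfl⟩, ?_⟩⟩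
      right; push_cast; rfl
    · refine ⟨key _ (Or.inr rfl), Or.inr ⟨((hi - 1 : ℤ) : ZMod n),
        (ha.mem_iff _).2 ⟨hi - 1, by omega, by omega, rfl⟩, ?_⟩⟩
      left; push_cast; ring

theorem IsArc.cons_left {h : List (ZMod n)} {lo hi : ℤ} (ha : IsArc h lo hi) (hn : h.length < n) :
    IsArc (((lo - 1 : ℤ) : ZMod n) :: h) (lo - 1) hi where
  length_eq := by have := ha.length_eq; simp; omega
  length_pos := by simp
  length_le := by simpa using hn
  mem_iff s := by
    have := ha.length_eq
    have := ha.length_pos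
    rw [List.mem_cons, ha.mem_iff]
    constructor
    · rintro (rfl | ⟨i, h1, h2, rfl⟩)
      · exact ⟨lo - 1, le_rfl, by omega, rfl⟩
      · exact ⟨i, by omega, h2, rfl⟩
    · rintro ⟨i, h1, h2, rfl⟩
      rcases eq_or_lt_of_le h1 with rfl | h1
      · exact Or.inl rfl
      · exact Or.inr ⟨i, by omega, h2, rfl⟩

theorem IsArc.cons_right {h : List (ZMod n)} {lo hi : ℤ} (ha : IsArc h lo hi) (hn : h.length < n) :
    IsArc ((hi : ZMod n) :: h) lo (hi + 1) where
  length_eq := by have := ha.length_eq; simp; omega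
  length_pos := by simp
  length_le := by simpa using hn
  mem_iff s := by
    have := ha.length_eq
    have := ha.length_pos
    rw [List.mem_cons, ha.mem_iff]
    constructor
    · rintro (rfl | ⟨i, h1, h2, rfl⟩)
      · exact ⟨hi, by omega, by omega, rfl⟩
      · exact ⟨i, h1, by omega, rfl⟩
    · rintro ⟨i, h1, h2, rfl⟩
      rcases eq_or_lt_of_le (show i ≤ hi by omega) with rfl | h2
      · exact Or.inl rfl
      · exact Or.inr ⟨i, h1, h2, rfl⟩

theorem Legal.isArc [NeZero n] {h : List (ZMod n)} (hl : Legal h) (hh : h ≠ []) (hn : h.length ≤ n) :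
    ∃ lo hi, IsArc h lo hi := by
  induction hl with
  | nil => exact absurd rfl hh
  | @cons h s hl hs ih =>
    rcases eq_or_ne h [] with rfl | hne
    · refine ⟨(s.val : ℤ), (s.val : ℤ) + 1, ?_⟩
      have := isArc_singleton (n := n) (s.val : ℤ)
      simpa using this
    · have hlt : h.length < n := by simpa using hn
      obtain ⟨lo, hi, ha⟩ := ih hne hlt.le
      rcases (ha.available_iff hlt s).1 hs with rfl | rfl
      · exact ⟨_, _, ha.cons_left hlt⟩
      · exact ⟨_, _, ha.cons_right hlt⟩

theorem Legal.exists_available [NeZero n] {h : List (ZMod n)} (hl : Legal h) (hn : h.length < n) :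
    ∃ s, Available h s := by
  rcases eq_or_ne h [] with rfl | hne
  · exact ⟨0, by simp, Or.inl rfl⟩
  · obtain ⟨lo, hi, ha⟩ := hl.isArc hne hn.le
    exact ⟨_, (ha.available_iff hn _).2 (Or.inr rfl)⟩

open Classical in
/-- If Alice can force `Q`, then she has a strategy all of whose plays satisfy `Q`. -/
theorem AliceForces.exists_strategy [NeZero n] {Q : List (ZMod n) → Prop}
    (hw : AliceForces Q n []) : ∃ σ : AliceStrategy n, ∀ h, IsPlay σ h → Q h := by
  let good : List (ZMod n) → ZMod n → Prop := fun h s =>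
    Available h s ∧ AliceForces Q (n - (h.length + 1)) (s :: h)
  -- The second branch keeps the strategy legal at histories where forcing has already failed; the
  -- value `0` occurs only where no slice is available.
  let mv : List (ZMod n) → ZMod n := fun h =>
    if hg : ∃ s, good h s then hg.choose
    else if ha : ∃ s, Available h s then ha.choose else 0
  let σ : AliceStrategy n :=
    { move := mv
      legal := by
        intro h hl _ hlt
        have ha := hl.exists_available hlt
        by_cases hg : ∃ s, good h s
        · simp only [mv, dif_pos hg]
          exact hg.choose_spec.1
        · simp only [mv, dif_neg hg, dif_pos ha]
          exact ha.choose_spec }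
  refine ⟨σ, ?_⟩
  have key : ∀ h : List (ZMod n), Legal h → h.length ≤ n → Follows σ h →
      AliceForces Q (n - h.length) h := by
    intro h
    induction h with
    | nil => intro _ _ _; simpa using hw
    | cons s h ih =>
      intro hl hn hf
      rcases hl with _ | ⟨hl, hs⟩
      have hlt : h.length < n := by simpa using hn
      have hrec := ih hl hlt.le hf.2
      rw [show n - h.length = (n - (h.length + 1)) + 1 by omega] at hrec
      rw [List.length_cons]
      unfold AliceForces at hrec
      split_ifs at hrec with he
      · have hg : ∃ s, good h s := hrec
        have hs' : s = mv h := hf.1 he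
        rw [hs']
        simp only [mv, dif_pos hg]
        exact hg.choose_spec.2
      · exact hrec s hs
  intro h ⟨h1, h2, h3⟩
  have := key h h1 h2.le h3
  rw [h2, Nat.sub_self] at this
  exact this

/-- If Bob can force `Q`, then against every strategy of Alice some play satisfies `Q`. -/
theorem BobForces.exists_play [NeZero n] {Q : List (ZMod n) → Prop} (hw : BobForces Q n [])
    (σ : AliceStrategy n) : ∃ h, IsPlay σ h ∧ Q h := by
  have key : ∀ k, k ≤ n → ∃ h : List (ZMod n), Legal h ∧ h.length = k ∧ Follows σ h ∧
      BobForces Q (n - k) h := by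
    intro k
    induction k with
    | zero => intro _; exact ⟨[], Legal.nil, rfl, trivial, by simpa using hw⟩
    | succ k ih =>
      intro hk
      obtain ⟨h, hl, hlen, hf, hb⟩ := ih (by omega)
      rw [show n - k = (n - (k + 1)) + 1 by omega] at hb
      unfold BobForces at hb
      split_ifs at hb with he
      · have hs := σ.legal h hl he (by omega)
        exact ⟨σ.move h :: h, Legal.cons hl hs, by simp [hlen], ⟨fun _ => rfl, hf⟩, hb _ hs⟩
      · obtain ⟨s, hs, hb⟩ := hb
        exact ⟨s :: h, Legal.cons hl hs, by simp [hlen], ⟨fun hc => absurd hc he, hf⟩, hb⟩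
  obtain ⟨h, h1, h2, h3, h4⟩ := key n le_rfl
  rw [Nat.sub_self] at h4
  exact ⟨h, ⟨h1, h2, h3⟩, h4⟩

/-! ### Numerical recursions for the two players -/

/-- The position after a turn of Alice in which the slices `[lo, hi)` are taken and `rem` slices remain:
Alice can collect at least `c` from the remaining slices with at most `J` jumps, where `w` gives the sizes.
Each pair of turns consists of a turn of Bob at either end and a shift or a jump of Alice. -/
def Collects (w : ℤ → ℝ) : ℕ → ℤ → ℤ → ℕ → ℝ → Prop
  | 0, _, _, _, c => c ≤ 0
  | 1, _, _, _, c => c ≤ 0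
  | r + 2, lo, hi, J, c =>
      (Collects w r (lo - 2) hi J (c - w (lo - 2)) ∨
        ∃ J', J = J' + 1 ∧ Collects w r (lo - 1) (hi + 1) J' (c - w hi)) ∧
      (Collects w r lo (hi + 2) J (c - w (hi + 1)) ∨
        ∃ J', J = J' + 1 ∧ Collects w r (lo - 1) (hi + 1) J' (c - w (lo - 1)))

theorem aliceGain_cons_cons_of_even (p : ZMod n → ℝ) {h : List (ZMod n)} (r s : ZMod n)
    (he : ¬ Even h.length) : aliceGain p (s :: r :: h) = p s + aliceGain p h := by
  have : Even (h.length + 1) := by rw [Nat.even_add_one]; exact he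
  simp [aliceGain, he, this]

theorem aliceJumps_cons_of_odd {h : List (ZMod n)} (r : ZMod n) (he : ¬ Even h.length) :
    aliceJumps (r :: h) = aliceJumps h := by
  cases h with
  | nil => simp at he
  | cons a t => simp only [aliceJumps, he, false_and, if_false, zero_add]

theorem aliceJumps_cons_le {h : List (ZMod n)} (s : ZMod n) :
    aliceJumps (s :: h) ≤ aliceJumps h + 1 := by
  cases h with
  | nil => simp [aliceJumps]
  | cons a t => rw [aliceJumps]; split_ifs <;> omega

theorem aliceJumps_cons_of_adjacent {h : List (ZMod n)} {r s : ZMod n} (ha : Adjacent r s) :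
    aliceJumps (s :: r :: h) = aliceJumps (r :: h) := by
  rw [aliceJumps, if_neg (fun hc => hc.2 ha), zero_add]

/-- `c` is what Alice has yet to collect and `J` her unspent jumps. A turn at the end away from
Bob's is charged as a jump even if it is adjacent to his slice (as for the last slice), which is
harmless for an upper bound. -/
theorem Collects.aliceForces (p : ZMod n → ℝ) (c₀ : ℝ) (j₀ : ℕ) :
    ∀ (r : ℕ) (h : List (ZMod n)) (lo hi : ℤ) (J : ℕ) (c : ℝ),
      Collects (fun i => p (i : ZMod n)) r lo hi J c → IsArc h lo hi → h.length + r = n →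
      ¬ Even h.length → c₀ ≤ aliceGain p h + c → aliceJumps h + J ≤ j₀ →
      AliceForces (fun h => c₀ ≤ aliceGain p h ∧ aliceJumps h ≤ j₀) r h
  | 0, h, lo, hi, J, c => by
    intro hc _ _ _ h1 h2
    simp only [Collects] at hc
    exact ⟨by linarith, by omega⟩
  | 1, h, lo, hi, J, c => by
    intro hc _ _ he h1 h2
    simp only [Collects] at hc
    simp only [AliceForces, if_neg he]
    intro s _
    refine ⟨?_, ?_⟩
    · simp only [aliceGain, if_neg he]; linarith
    · rw [aliceJumps_cons_of_odd s he]; omega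
  | r + 2, h, lo, hi, J, c => by
    intro hc ha hr he h1 h2
    have he' : Even (h.length + 1) := by rw [Nat.even_add_one]; exact he
    have he'' : ¬ Even (h.length + 1 + 1) := by rw [Nat.even_add_one]; exact not_not.2 he'
    unfold AliceForces
    rw [if_neg he]
    intro b hb
    unfold AliceForces
    rw [List.length_cons, if_pos he']
    simp only [Collects] at hc
    rcases (ha.available_iff (by omega) b).1 hb with rfl | rfl
    · have hbA := ha.cons_left (by omega)
      have hlt : (((lo - 1 : ℤ) : ZMod n) :: h).length < n := by simp; omega
      rcases hc.1 with hk | ⟨J', rfl, hk⟩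
      · have hA := hbA.cons_left hlt
        refine ⟨_, (hbA.available_iff hlt _).2 (Or.inl rfl), ?_⟩
        rw [show lo - 1 - 1 = lo - 2 by ring] at hA ⊢
        refine Collects.aliceForces p c₀ j₀ r _ _ _ J _ hk hA (by simp; omega) (by simpa using he'') ?_ ?_
        · rw [aliceGain_cons_cons_of_even p _ _ he]; linarith
        · rw [aliceJumps_cons_of_adjacent, aliceJumps_cons_of_odd _ he]
          · exact h2
          · right; push_cast; ring
      · have hA := hbA.cons_right hlt
        refine ⟨_, (hbA.available_iff hlt _).2 (Or.inr rfl), ?_⟩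
        refine Collects.aliceForces p c₀ j₀ r _ _ _ J' _ hk hA (by simp; omega) (by simpa using he'') ?_ ?_
        · rw [aliceGain_cons_cons_of_even p _ _ he]; linarith
        · refine (Nat.add_le_add_right (aliceJumps_cons_le _) _).trans ?_
          rw [aliceJumps_cons_of_odd _ he]; omega
    · have hbA := ha.cons_right (by omega)
      have hlt : ((hi : ZMod n) :: h).length < n := by simp; omega
      rcases hc.2 with hk | ⟨J', rfl, hk⟩
      · have hA := hbA.cons_right hlt
        refine ⟨_, (hbA.available_iff hlt _).2 (Or.inr rfl), ?_⟩
        rw [show hi + 1 + 1 = hi + 2 by ring] at hA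
        refine Collects.aliceForces p c₀ j₀ r _ _ _ J _ hk hA (by simp; omega) (by simpa using he'') ?_ ?_
        · rw [aliceGain_cons_cons_of_even p _ _ he]; linarith
        · rw [aliceJumps_cons_of_adjacent, aliceJumps_cons_of_odd _ he]
          · exact h2
          · left; push_cast; ring
      · have hA := hbA.cons_left hlt
        refine ⟨_, (hbA.available_iff hlt _).2 (Or.inl rfl), ?_⟩
        refine Collects.aliceForces p c₀ j₀ r _ _ _ J' _ hk hA (by simp; omega) (by simpa using he'') ?_ ?_
        · rw [aliceGain_cons_cons_of_even p _ _ he]; linarith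
        · refine (Nat.add_le_add_right (aliceJumps_cons_le _) _).trans ?_
          rw [aliceJumps_cons_of_odd _ he]; omega

theorem Collects.exists_strategy [NeZero n] {p : ZMod n → ℝ} {v : ℤ} {J : ℕ} {c : ℝ}
    (hc : Collects (fun i => p (i : ZMod n)) (n - 1) v (v + 1) J (c - p (v : ZMod n))) :
    ∃ σ : AliceStrategy n, IsJumpStrategy J σ ∧ HasGain σ p c := by
  have hn : 1 ≤ n := Nat.one_le_iff_ne_zero.2 (NeZero.ne n)
  have hw : AliceForces (fun h => c ≤ aliceGain p h ∧ aliceJumps h ≤ J) (n - 1 + 1) [] := by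
    unfold AliceForces
    rw [if_pos (by simp)]
    refine ⟨((v : ℤ) : ZMod n), ⟨by simp, Or.inl rfl⟩, ?_⟩
    refine hc.aliceForces p c J _ _ _ _ J _ (isArc_singleton v) (by simp; omega) (by simp) ?_ ?_
    · simp [aliceGain]
    · simp [aliceJumps]
  rw [Nat.sub_add_cancel hn] at hw
  obtain ⟨σ, hσ⟩ := hw.exists_strategy
  exact ⟨σ, fun h hh => (hσ h hh).2, fun h hh => (hσ h hh).1⟩

/-- The slices `[x, x + r)` remain, and it is Alice's turn if `a` is true and Bob's otherwise:
Bob can prevent Alice from collecting more than `c` from the remaining slices of sizes `w`. -/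
def Restricts (w : ℤ → ℝ) : ℕ → Bool → ℤ → ℝ → Prop
  | 0, _, _, c => 0 ≤ c
  | r + 1, true, x, c =>
      Restricts w r false (x + 1) (c - w x) ∧ Restricts w r false x (c - w (x + r))
  | r + 1, false, x, c => Restricts w r true (x + 1) c ∨ Restricts w r true x c

theorem Restricts.bobForces (p : ZMod n → ℝ) (c₀ : ℝ) :
    ∀ (r : ℕ) (h : List (ZMod n)) (lo hi : ℤ) (a : Bool) (c : ℝ),
      Restricts (fun i => p (i : ZMod n)) r a hi c → IsArc h lo hi → h.length + r = n →
      (Even h.length ↔ a = true) → aliceGain p h + c ≤ c₀ →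
      BobForces (fun h => aliceGain p h ≤ c₀) r h := by
  intro r
  induction r with
  | zero =>
    intro h lo hi a c hc _ _ _ h1
    simp only [Restricts] at hc
    show aliceGain p h ≤ c₀
    linarith
  | succ r ih =>
    intro h lo hi a c hc ha hr he h1
    have hlt : h.length < n := by omega
    -- The arc and the remaining interval `[hi, hi + r]` make one full circle, so the slice before
    -- the arc is the last remaining one.
    have hend : ((lo - 1 : ℤ) : ZMod n) = ((hi + r : ℤ) : ZMod n) := by
      rw [ZMod.intCast_eq_intCast_iff_dvd_sub]
      refine ⟨1, ?_⟩
      have := ha.length_eq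
      omega
    unfold BobForces
    cases a with
    | true =>
      have he' : Even h.length := he.2 rfl
      have hp : ∀ s : ZMod n, (Even (s :: h).length ↔ false = true) := by
        intro s
        simp [Nat.even_add_one, he']
      rw [if_pos he']
      simp only [Restricts] at hc
      intro s hs
      rcases (ha.available_iff hlt s).1 hs with rfl | rfl
      · refine ih _ _ _ false _ hc.2 (ha.cons_left hlt) (by simp; omega) (hp _) ?_
        have h2 := congrArg p hend
        simp only [aliceGain, if_pos he', h2]
        linarith
      · refine ih _ _ _ false _ hc.1 (ha.cons_right hlt) (by simp; omega) (hp _) ?_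
        simp only [aliceGain, if_pos he']
        linarith
    | false =>
      have he' : ¬ Even h.length := fun hh => by simpa using he.1 hh
      have hp : ∀ s : ZMod n, (Even (s :: h).length ↔ true = true) := by
        intro s
        simpa [Nat.even_add_one] using he'
      rw [if_neg he']
      simp only [Restricts] at hc
      rcases hc with hc | hc
      · refine ⟨_, (ha.available_iff hlt _).2 (Or.inr rfl), ih _ _ _ true _ hc (ha.cons_right hlt)
          (by simp; omega) (hp _) ?_⟩
        simp only [aliceGain, if_neg he']
        linarith
      · refine ⟨_, (ha.available_iff hlt _).2 (Or.inl rfl), ih _ _ _ true _ hc (ha.cons_left hlt)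
          (by simp; omega) (hp _) ?_⟩
        simp only [aliceGain, if_neg he']
        linarith

theorem HasGain.le_of_restricts [NeZero n] {p : ZMod n → ℝ} {c d : ℝ}
    (hr : ∀ v : ℕ, v < n →
      Restricts (fun i => p (i : ZMod n)) (n - 1) false (v + 1) (d - p (v : ZMod n)))
    {σ : AliceStrategy n} (hσ : HasGain σ p c) : c ≤ d := by
  have hn : 1 ≤ n := Nat.one_le_iff_ne_zero.2 (NeZero.ne n)
  have hw : BobForces (fun h => aliceGain p h ≤ d) (n - 1 + 1) [] := by
    unfold BobForces
    rw [if_pos (by simp)]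
    intro s _
    have hs := isArc_singleton (n := n) (s.val : ℤ)
    have h1 := hr s.val s.val_lt
    simp only [Int.cast_natCast, ZMod.natCast_zmod_val] at hs h1
    refine h1.bobForces p d _ _ _ _ _ _ hs (by simp; omega) (by simp) ?_
    simp [aliceGain]
  rw [Nat.sub_add_cancel hn] at hw
  obtain ⟨h, h1, h2⟩ := hw.exists_play σ
  exact (hσ h h1).trans h2

end Pizza

/-! ### Shifts and jumps on the characteristic cycle -/

namespace Pizza

/-- The game for odd `n = 2 M - 1` on the characteristic cycle, in which slice `2 u` has index `u`, with
prefix sums `S` of the sizes. After a turn of Alice with `2 r` remaining slices, the slices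
`[u, u + M - r)` and the opposite ones `[u + M, u + 2 M - r - 1)` are taken, and a shift of Alice extends the
first of these arcs. Alice can collect at least `c` from the rest with at most `J` jumps. -/
def Gains (S : ℤ → ℝ) (M : ℤ) : ℕ → ℤ → ℕ → ℝ → Prop
  | 0, _, _, c => c ≤ 0
  | r + 1, u, J, c =>
      (Gains S M r (u - 1) J (c - (S u - S (u - 1))) ∨
        ∃ J', J = J' + 1 ∧
          Gains S M r (u + M - 1) J' (c - (S (u + 2 * M - r - 1) - S (u + 2 * M - r - 2)))) ∧
      (Gains S M r u J (c - (S (u + M - r) - S (u + M - r - 1))) ∨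
        ∃ J', J = J' + 1 ∧ Gains S M r (u + M - 1) J' (c - (S (u + M) - S (u + M - 1))))

theorem Gains.mono_gain {S : ℤ → ℝ} {M : ℤ} : ∀ {r : ℕ} {u : ℤ} {J : ℕ} {c d : ℝ},
    Gains S M r u J c → d ≤ c → Gains S M r u J d := by
  intro r
  induction r with
  | zero => intro u J c d h hd; exact hd.trans h
  | succ r ih =>
    intro u J c d h hd
    refine ⟨h.1.imp (fun h => ih h (by linarith)) ?_, h.2.imp (fun h => ih h (by linarith)) ?_⟩ <;>
    · rintro ⟨J', rfl, hk⟩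
      exact ⟨J', rfl, ih hk (by linarith)⟩

/-- Alice only makes shifts. -/
theorem gains_of_shifts {S : ℤ → ℝ} {M : ℤ} (J : ℕ) : ∀ (r : ℕ) (u : ℤ) (c : ℝ),
    (∀ i, u - r ≤ i → i ≤ u → c ≤ S (i + M) - S i - (S (u + M - r) - S u)) →
    Gains S M r u J c := by
  intro r
  -- The arc `[u, u + M - r)` grows to some half-circle `[i, i + M)` containing it; Bob decides
  -- which.
  induction r with
  | zero =>
    intro u c h
    have := h u (by simp) le_rfl
    simp only [Nat.cast_zero, sub_zero] at this
    show c ≤ 0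
    linarith
  | succ r ih =>
    intro u c h
    push_cast at h
    refine ⟨Or.inl (ih _ _ ?_), Or.inl (ih _ _ ?_)⟩
    · intro i h1 h2
      have := h i (by omega) (by omega)
      rw [show u - 1 + M - (r : ℤ) = u + M - (r + 1) by ring]
      linarith
    · intro i h1 h2
      have := h i (by omega) (by omega)
      rw [show u + M - (r : ℤ) - 1 = u + M - (r + 1) by ring]
      linarith

/-- Alice shifts until she would leave the arc `[X, Y)`, when she jumps, and only shifts from then on. -/
theorem gains_of_jump_at_exit {S : ℤ → ℝ} {M X Y : ℤ} {κ : ℝ} (hXY : Y - X < M) (J : ℕ)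
    (hκ : ∀ i, X + 1 ≤ i → i ≤ Y + M - 2 → κ ≤ S (i + M) - S i) :
    ∀ (r : ℕ) (u : ℤ) (c : ℝ), X ≤ u → u + M - r ≤ Y → u < u + M - r →
      (∀ z, u + M - r ≤ z → z ≤ Y → c ≤ S z - S X - (S (u + M - r) - S u) + κ -
        (S (z + M - 1) - S (X + M - 1))) →
      (∀ z, X ≤ z → z ≤ u → c ≤ S Y - S z - (S (u + M - r) - S u) + κ -
        (S (Y + M) - S (z + M))) →
      Gains S M r u (J + 1) c := by
  intro r
  induction r with
  | zero =>
    intro u c h1 h2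
    simp only [Nat.cast_zero] at h2
    omega
  | succ r ih =>
    intro u c h1 h2 h3 hl hr
    push_cast at h2 h3 hl hr
    rw [show u + M - ((r : ℤ) + 1) = u + M - r - 1 by ring] at h2 h3 hl hr
    constructor
    · rcases eq_or_lt_of_le h1 with rfl | h1
      -- Alice holds `[X, z)` with `z = X + M - r - 1`, and `[X + M - 1, z + M - 1)` counts as
      -- Bob's. She jumps to `z + M - 1`; the arc extended from now on contains Bob's slices and
      -- ends as a half-circle of size at least `κ`, from which they are subtracted. The right exit
      -- is symmetric.
      · refine Or.inr ⟨J, rfl, gains_of_shifts J r _ _ ?_⟩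
        intro i hi1 hi2
        have e1 := hl (X + M - r - 1) le_rfl h2
        have e2 := hκ i (by omega) (by omega)
        rw [show X + M - (r : ℤ) - 1 + M - 1 = X + 2 * M - r - 2 by ring] at e1
        rw [show X + M - 1 + M - (r : ℤ) = X + 2 * M - r - 1 by ring]
        linarith
      · refine Or.inl (ih _ _ (by omega) (by omega) (by omega) ?_ ?_)
        · intro z hz1 hz2
          have := hl z (by omega) hz2
          rw [show u - 1 + M - (r : ℤ) = u + M - r - 1 by ring]
          linarith
        · intro z hz1 hz2
          have := hr z hz1 (by omega)
          rw [show u - 1 + M - (r : ℤ) = u + M - r - 1 by ring]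
          linarith
    · rcases eq_or_lt_of_le h2 with h2 | h2
      · refine Or.inr ⟨J, rfl, gains_of_shifts J r _ _ ?_⟩
        intro i hi1 hi2
        have e1 := hr u h1 le_rfl
        have e2 := hκ i (by omega) (by omega)
        rw [h2, show Y + M = u + M - 1 + M - r by omega] at e1
        linarith
      · refine Or.inl (ih _ _ h1 (by omega) (by omega) ?_ ?_)
        · intro z hz1 hz2
          have := hl z (by omega) hz2
          linarith
        · intro z hz1 hz2
          have := hr z hz1 hz2
          linarith

/-- Alice shifts until she would leave the arc `[a, d)`, when she jumps to the opposite arc `[X, Y)`; there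
she shifts until she would leave it, when she jumps again, and only shifts from then on. -/
theorem gains_of_detour {S : ℤ → ℝ} {M X Y a d : ℤ} {κ : ℝ} (hXY : Y - X < M) (hX : X ≤ a + M - 1)
    (hY : d + M ≤ Y) (J : ℕ) (hκ : ∀ i, X + 1 ≤ i → i ≤ Y + M - 2 → κ ≤ S (i + M) - S i) :
    ∀ (r : ℕ) (u : ℤ) (c : ℝ), a ≤ u → u + M - r ≤ d → u < u + M - r →
      (∀ e, u + M - r ≤ e → e ≤ d → ∀ z, e + M ≤ z → z ≤ Y →
        c ≤ S e - S a - (S (u + M - r) - S u) - (S (e + M - 1) - S (a + M - 1)) +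
          (S z - S X + κ - (S (z + M - 1) - S (X + M - 1)))) →
      (∀ e, u + M - r ≤ e → e ≤ d → ∀ z, X ≤ z → z ≤ a + M - 1 →
        c ≤ S e - S a - (S (u + M - r) - S u) - (S (e + M - 1) - S (a + M - 1)) +
          (S Y - S z + κ - (S (Y + M) - S (z + M)))) →
      (∀ t, a ≤ t → t ≤ u → ∀ z, d + M ≤ z → z ≤ Y →
        c ≤ S d - S t - (S (u + M - r) - S u) - (S (d + M) - S (t + M)) +
          (S z - S X + κ - (S (z + M - 1) - S (X + M - 1)))) →
      (∀ t, a ≤ t → t ≤ u → ∀ z, X ≤ z → z ≤ t + M - 1 →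
        c ≤ S d - S t - (S (u + M - r) - S u) - (S (d + M) - S (t + M)) +
          (S Y - S z + κ - (S (Y + M) - S (z + M)))) →
      Gains S M r u (J + 2) c := by
  intro r
  induction r with
  | zero =>
    intro u c h1 h2
    simp only [Nat.cast_zero] at h2
    omega
  | succ r ih =>
    intro u c h1 h2 h3 g1 g2 g3 g4
    push_cast at h2 h3 g1 g2 g3 g4
    rw [show u + M - ((r : ℤ) + 1) = u + M - r - 1 by ring] at h2 h3
    simp only [show u + M - ((r : ℤ) + 1) = u + M - r - 1 by ring] at g1 g2 g3 g4
    constructor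
    · rcases eq_or_lt_of_le h1 with rfl | h1
      -- With `e = a + M - r - 1`, Bob's slices `[a + M - 1, e + M - 1)` lie in `[X, Y)` and are
      -- subtracted there. Alice's `[a, e)` lies, a period later, opposite to `[X, Y)`, where the
      -- last phase may count it as Bob's; it is added back.
      · refine Or.inr ⟨J + 1, rfl, gains_of_jump_at_exit hXY J hκ r _ _ (by omega) (by omega)
          (by omega) ?_ ?_⟩
        · intro z hz1 hz2
          have := g1 (a + M - r - 1) le_rfl h2 z (by omega) hz2
          rw [show a + M - (r : ℤ) - 1 + M - 1 = a + 2 * M - r - 2 by ring] at this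
          rw [show a + M - 1 + M - (r : ℤ) = a + 2 * M - r - 1 by ring]
          linarith
        · intro z hz1 hz2
          have := g2 (a + M - r - 1) le_rfl h2 z hz1 hz2
          rw [show a + M - (r : ℤ) - 1 + M - 1 = a + 2 * M - r - 2 by ring] at this
          rw [show a + M - 1 + M - (r : ℤ) = a + 2 * M - r - 1 by ring]
          linarith
      · refine Or.inl (ih _ _ (by omega) (by omega) (by omega) ?_ ?_ ?_ ?_) <;>
          rw [show u - 1 + M - (r : ℤ) = u + M - r - 1 by ring]
        · intro e he1 he2 z hz1 hz2
          have := g1 e he1 he2 z hz1 hz2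
          linarith
        · intro e he1 he2 z hz1 hz2
          have := g2 e he1 he2 z hz1 hz2
          linarith
        · intro t ht1 ht2 z hz1 hz2
          have := g3 t ht1 (by omega) z hz1 hz2
          linarith
        · intro t ht1 ht2 z hz1 hz2
          have := g4 t ht1 (by omega) z hz1 hz2
          linarith
    · rcases eq_or_lt_of_le h2 with h2 | h2
      · refine Or.inr ⟨J + 1, rfl, gains_of_jump_at_exit hXY J hκ r _ _ (by omega) (by omega)
          (by omega) ?_ ?_⟩
        · intro z hz1 hz2
          have := g3 u h1 le_rfl z (by omega) hz2
          rw [h2] at this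
          rw [show u + M - 1 + M - (r : ℤ) = d + M by omega]
          linarith
        · intro z hz1 hz2
          have := g4 u h1 le_rfl z hz1 hz2
          rw [h2] at this
          rw [show u + M - 1 + M - (r : ℤ) = d + M by omega]
          linarith
      · refine Or.inl (ih _ _ h1 (by omega) (by omega) ?_ ?_ ?_ ?_)
        · intro e he1 he2 z hz1 hz2
          have := g1 e (by omega) he2 z hz1 hz2
          linarith
        · intro e he1 he2 z hz1 hz2
          have := g2 e (by omega) he2 z hz1 hz2
          linarith
        · intro t ht1 ht2 z hz1 hz2
          have := g3 t ht1 ht2 z hz1 hz2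
          linarith
        · intro t ht1 ht2 z hz1 hz2
          have := g4 t ht1 ht2 z hz1 hz2
          linarith

end Pizza

/-! ### Half-circles, and what one or two jumps secure -/

namespace Pizza

/-- `S` is the sequence of prefix sums of nonnegative sizes on a cycle of `2 M - 1` slices of total size `T`. -/
structure IsPrefixSum (S : ℤ → ℝ) (M : ℤ) (T : ℝ) : Prop where
  one_le : 1 ≤ M
  mono : Monotone S
  add_period : ∀ i, S (i + (2 * M - 1)) = S i + T

/-- The total size of the half-circle that starts at `i`. -/
def half (S : ℤ → ℝ) (M i : ℤ) : ℝ := S (i + M) - S i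

/-- Alice has a strategy on the characteristic cycle with gain `c` and at most `J` jumps. -/
def Secures (S : ℤ → ℝ) (M : ℤ) (J : ℕ) (c : ℝ) : Prop :=
  ∃ v, Gains S M (M - 1).toNat v J (c - (S (v + 1) - S v))

theorem Secures.mono {S : ℤ → ℝ} {M : ℤ} {J : ℕ} {c d : ℝ} (h : Secures S M J c) (hd : d ≤ c) :
    Secures S M J d :=
  h.imp fun _ h => h.mono_gain (by linarith)

variable {S : ℤ → ℝ} {M : ℤ} {T : ℝ}

theorem IsPrefixSum.half_add_period (hS : IsPrefixSum S M T) (i : ℤ) :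
    half S M (i + (2 * M - 1)) = half S M i := by
  unfold half
  rw [show i + (2 * M - 1) + M = i + M + (2 * M - 1) by ring, hS.add_period, hS.add_period]
  ring

theorem IsPrefixSum.half_add_mul_period (hS : IsPrefixSum S M T) (i k : ℤ) :
    half S M (i + k * (2 * M - 1)) = half S M i := by
  induction k using Int.induction_on with
  | zero => simp
  | succ k ih => rw [← ih, ← hS.half_add_period (i + k * (2 * M - 1))]; congr 1; ring
  | pred k ih => rw [← ih, ← hS.half_add_period (i + (-(k : ℤ) - 1) * (2 * M - 1))]; congr 1; ring

theorem IsPrefixSum.secures_of_le_half (hS : IsPrefixSum S M T) {v : ℤ} {c : ℝ} (J : ℕ)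
    (h : ∀ i, v - M + 1 ≤ i → i ≤ v → c ≤ half S M i) : Secures S M J c := by
  have h1 := hS.one_le
  refine ⟨v, gains_of_shifts J _ _ _ fun i hi1 hi2 => ?_⟩
  have hc : (((M - 1).toNat : ℕ) : ℤ) = M - 1 := Int.toNat_of_nonneg (by omega)
  rw [hc] at hi1 ⊢
  have := h i (by omega) hi2
  unfold half at this
  rw [show v + M - (M - 1) = v + 1 by ring]
  linarith

/-- `κ` bounds every half-circle in which Alice can finish after her jump; `[X, z)` and `[z, Y)` are
what she may hold when leaving at the left or right end. -/
theorem IsPrefixSum.secures_of_exits (hS : IsPrefixSum S M T) {X Y v : ℤ} {κ c : ℝ} (J : ℕ)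
    (hXY : Y - X < M) (hv : X ≤ v)
    (hv' : v < Y) (hκ : ∀ i, X + 1 ≤ i → i ≤ Y + M - 2 → κ ≤ half S M i)
    (hl : ∀ z, v + 1 ≤ z → z ≤ Y → c ≤ S z - S X + κ - (S (z + M - 1) - S (X + M - 1)))
    (hr : ∀ z, X ≤ z → z ≤ v → c ≤ S Y - S z + κ - (S (Y + M) - S (z + M))) :
    Secures S M (J + 1) c := by
  have h1 := hS.one_le
  have hc : (((M - 1).toNat : ℕ) : ℤ) = M - 1 := Int.toNat_of_nonneg (by omega)
  have he : v + M - (M - 1) = v + 1 := by ring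
  refine ⟨v, gains_of_jump_at_exit hXY J hκ _ _ _ hv (by omega) (by omega) ?_ ?_⟩ <;> rw [hc, he]
  · intro z hz1 hz2
    have := hl z hz1 hz2
    linarith
  · intro z hz1 hz2
    have := hr z hz1 hz2
    linarith

theorem exists_median (hS : Monotone S) {a d : ℤ} (had : a < d) :
    ∃ v, a ≤ v ∧ v < d ∧ (S d - S a) / 2 ≤ S (v + 1) - S a ∧ (S d - S a) / 2 ≤ S d - S v := by
  obtain ⟨v, ⟨hv1, hv2, hv3⟩, hmin⟩ := Int.exists_least_of_bdd
    (P := fun v => a ≤ v ∧ v < d ∧ (S d - S a) / 2 ≤ S (v + 1) - S a)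
    ⟨a, fun z hz => hz.1⟩ ⟨d - 1, by omega, by omega, by
      have := hS had.le
      rw [sub_add_cancel]; linarith⟩
  refine ⟨v, hv1, hv2, hv3, ?_⟩
  have hda := hS had.le
  rcases eq_or_lt_of_le hv1 with rfl | hlt
  · linarith
  · by_contra hc
    have := hmin (v - 1) ⟨by omega, by omega, by rw [sub_add_cancel]; linarith⟩
    omega

/-- If every one-jump start in `[X, Y)` fails, a large part of the opposite arc is concentrated in a
middle piece. Starting at the median of that piece and making a detour through `[X, Y)` then
succeeds. The factor 3/4 balances the two plans. -/
theorem IsPrefixSum.secures_two_jumps (hS : IsPrefixSum S M T) {X Y : ℤ} {κ c : ℝ}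
    (hlt : X < Y) (hXY : Y - X < M)
    (hκ : ∀ i, X + 1 ≤ i → i ≤ Y + M - 2 → κ ≤ half S M i)
    (hc : c = κ + (S Y - S X) / 2 - 3 / 4 * (S (Y + M) - S (X + M - 1))) (hκc : κ < c) :
    Secures S M 2 c := by
  have h1 := hS.one_le
  have hm := hS.mono
  let lf : ℤ → ℝ := fun z => S z - S X + κ - (S (z + M - 1) - S (X + M - 1))
  let rf : ℤ → ℝ := fun z => S Y - S z + κ - (S (Y + M) - S (z + M))
  by_contra hno
  have hfail : ∀ v, X ≤ v → v < Y → (∃ z, v + 1 ≤ z ∧ z ≤ Y ∧ lf z < c) ∨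
      ∃ z, X ≤ z ∧ z ≤ v ∧ rf z < c := by
    intro v hv hv'
    by_contra hcon
    push Not at hcon
    exact hno (hS.secures_of_exits 1 hXY hv hv' hκ hcon.1 hcon.2)
  have hE : 0 ≤ S (Y + M) - S (X + M - 1) := sub_nonneg.2 (hm (by omega))
  have hlY : c ≤ lf Y := by
    have : S (Y + M - 1) ≤ S (Y + M) := hm (by omega)
    simp only [lf]; linarith
  have hrX : c ≤ rf X := by
    have : S (X + M - 1) ≤ S (X + M) := hm (by omega)
    simp only [rf]; linarith
  -- A start at `Y - 1` can fail only at a right exit, as `c ≤ lf Y`. A start just before the first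
  -- bad right exit `α` can fail only at a left exit, which gives a bad `β ≥ α`.
  obtain ⟨α, ⟨hα1, hα2, hα3⟩, hαmin⟩ := Int.exists_least_of_bdd
    (P := fun z => X ≤ z ∧ z < Y ∧ rf z < c) ⟨X, fun z hz => hz.1⟩ (by
      rcases hfail (Y - 1) (by omega) (by omega) with ⟨z, hz1, hz2, hz3⟩ | ⟨z, hz1, hz2, hz3⟩
      · obtain rfl : z = Y := by omega
        linarith
      · exact ⟨z, hz1, by omega, hz3⟩)
  have hαX : X < α := by
    rcases eq_or_lt_of_le hα1 with rfl | h
    · linarith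
    · exact h
  obtain ⟨β, ⟨hβ1, hβ2, hβ3⟩, hβmax⟩ := Int.exists_greatest_of_bdd
    (P := fun z => α ≤ z ∧ z ≤ Y ∧ lf z < c) ⟨Y, fun z hz => hz.2.1⟩ (by
      rcases hfail (α - 1) (by omega) (by omega) with ⟨z, hz1, hz2, hz3⟩ | ⟨z, hz1, hz2, hz3⟩
      · exact ⟨z, by omega, hz2, hz3⟩
      · have := hαmin z ⟨hz1, by omega, hz3⟩
        omega)
  have hrf : ∀ z, X ≤ z → z ≤ α → rf α ≤ rf z := by
    intro z hz1 hz2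
    rcases eq_or_lt_of_le hz2 with rfl | hz2
    · exact le_rfl
    · by_contra hcon
      have := hαmin z ⟨hz1, by omega, by linarith⟩
      omega
  have hlf : ∀ z, β ≤ z → z ≤ Y → lf β ≤ lf z := by
    intro z hz1 hz2
    rcases eq_or_lt_of_le hz1 with rfl | hz1
    · exact le_rfl
    · by_contra hcon
      have := hβmax z ⟨by omega, hz2, by linarith⟩
      omega
  have hαβ : S α ≤ S β := hm hβ1
  have hper : ∀ i, S (i + M) = S (i - M + 1) + T := by
    intro i
    rw [← hS.add_period]; congr 1; ring
  have hμle : S (β - M) - S (α - M + 1) ≤ S (Y + M) - S (X + M - 1) := by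
    have e1 : S (β - M) ≤ S (Y - M + 1) := hm (by omega)
    have e2 : S (X - 1 - M + 1) ≤ S (α - M + 1) := hm (by omega)
    have e3 := hper (X - 1)
    rw [show X - 1 + M = X + M - 1 by ring] at e3
    rw [hper Y, e3]
    linarith
  have eβ : S (β + M - 1) = S (β - M) + T := by
    rw [← hS.add_period]; congr 1; ring
  have eα := hper α
  simp only [lf] at hβ3
  simp only [rf] at hα3
  rw [eβ] at hβ3
  rw [eα] at hα3
  -- Let `μ` be the size of `[α - M + 1, β - M)` and `E` that of `[X + M - 1, Y + M)`. Then `lf β +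
  -- rf α = 2c + E/2 + (S β - S α) - μ`, and both terms on the left are below `c`.
  have hμ : 0 < S (β - M) - S (α - M + 1) := by linarith
  have had : α - M + 1 < β - M := by
    by_contra hcon
    have := hm (show β - M ≤ α - M + 1 by omega)
    linarith
  obtain ⟨v, hv1, hv2, hv3, hv4⟩ := exists_median hm had
  refine hno ⟨v, ?_⟩
  have hcM : (((M - 1).toNat : ℕ) : ℤ) = M - 1 := Int.toNat_of_nonneg (by omega)
  have he : v + M - (M - 1) = v + 1 := by ring
  -- Alice leaves the middle piece with at least `μ/2`, and Bob then holds at most `S β - S α`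
  -- opposite. As one of `lf β`, `rf α` is below `c`, the other exceeds `c + E/2 + (S β - S α) - μ`;
  -- with `μ ≤ E` the total reaches `c`.
  refine gains_of_detour (a := α - M + 1) (d := β - M) hXY (by omega) (by omega) 0 hκ _ _ _ hv1
    (by omega) (by omega) ?_ ?_ ?_ ?_ <;> rw [hcM, he]
  · intro e he1 he2 z hz1 hz2
    have f1 : S (v + 1) ≤ S e := hm he1
    have f2 : S (e + M - 1) ≤ S z := hm (by omega)
    have f3 : S (e + M - 1) ≤ S β := hm (by omega)
    rw [show α - M + 1 + M - 1 = α by ring]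
    rcases le_total z β with h | h
    · have f4 : S (z + M - 1) ≤ S (β + M - 1) := hm (by omega)
      linarith
    · have f4 := hlf z h hz2
      simp only [lf] at f4
      linarith
  · intro e he1 he2 z hz1 hz2
    have f1 : S (v + 1) ≤ S e := hm he1
    have f3 : S (e + M - 1) ≤ S β := hm (by omega)
    rw [show α - M + 1 + M - 1 = α by ring]
    have f4 := hrf z hz1 (by omega)
    simp only [rf] at f4
    linarith
  · intro t ht1 ht2 z hz1 hz2
    have f1 : S t ≤ S v := hm ht2
    have f3 : S α ≤ S (t + M) := hm (by omega)
    rw [show β - M + M = β by ring]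
    have f4 := hlf z (by omega) hz2
    simp only [lf] at f4
    linarith
  · intro t ht1 ht2 z hz1 hz2
    have f1 : S t ≤ S v := hm ht2
    have f2 : S z ≤ S (t + M) := hm (by omega)
    have f3 : S α ≤ S (t + M) := hm (by omega)
    rw [show β - M + M = β by ring]
    rcases le_total α z with h | h
    · have f4 : S (α + M) ≤ S (z + M) := hm (by omega)
      linarith
    · have f4 := hrf z hz1 h
      simp only [rf] at f4
      linarith

end Pizza

/-! ### The potential and minimal covering triples -/

namespace Pizza

variable {S : ℤ → ℝ} {M : ℤ} {T : ℝ}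

/-- The potential of the cycle: every slice lies in a half-circle of size at most `p`, and the half-circles
through some slice all have size at least `p`. -/
theorem IsPrefixSum.exists_potential (hS : IsPrefixSum S M T) :
    ∃ p, (∃ v, ∀ i, v - M + 1 ≤ i → i ≤ v → p ≤ half S M i) ∧
      ∀ v, ∃ i, v - M + 1 ≤ i ∧ i ≤ v ∧ half S M i ≤ p := by
  have h1 := hS.one_le
  have hmin : ∀ v : ℤ, ∃ i ∈ Finset.Icc (v - M + 1) v, ∀ k ∈ Finset.Icc (v - M + 1) v,
      half S M i ≤ half S M k := fun v =>
    Finset.exists_min_image _ _ ⟨v, Finset.mem_Icc.2 ⟨by omega, le_rfl⟩⟩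
  choose f hf hf' using hmin
  obtain ⟨v, -, hv⟩ := Finset.exists_max_image (Finset.Ico 0 (2 * M - 1)) (fun v => half S M (f v))
    ⟨0, Finset.mem_Ico.2 ⟨le_rfl, by omega⟩⟩
  refine ⟨half S M (f v), ⟨v, fun i h1 h2 => hf' v i (Finset.mem_Icc.2 ⟨h1, h2⟩)⟩, fun w => ?_⟩
  have hw := hv (w % (2 * M - 1)) (Finset.mem_Ico.2
    ⟨Int.emod_nonneg _ (by omega), Int.emod_lt_of_pos _ (by omega)⟩)
  have hf1 := Finset.mem_Icc.1 (hf (w % (2 * M - 1)))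
  have hw2 := Int.emod_add_mul_ediv w (2 * M - 1)
  rw [mul_comm (2 * M - 1)] at hw2
  refine ⟨f (w % (2 * M - 1)) + w / (2 * M - 1) * (2 * M - 1), by linarith, by linarith, ?_⟩
  rwa [hS.half_add_mul_period]

/-- The half-circles that start at `x`, `y`, `z` cover the cycle, in this cyclic order. -/
structure Covers (M x y z : ℤ) : Prop where
  xy : x ≤ y
  xy' : y ≤ x + M
  yz : y ≤ z
  yz' : z ≤ y + M
  zx : z ≤ x + (2 * M - 1)
  zx' : x + (2 * M - 1) ≤ z + M

/-- A covering triple of half-circles of sizes at most `p` whose total size is minimal among these triples. -/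
structure MinTriple (S : ℤ → ℝ) (M : ℤ) (p : ℝ) (x y z : ℤ) : Prop where
  covers : Covers M x y z
  hx : half S M x ≤ p
  hy : half S M y ≤ p
  hz : half S M z ≤ p
  minimal : ∀ x' y' z', Covers M x' y' z' → half S M x' ≤ p → half S M y' ≤ p → half S M z' ≤ p →
    half S M x + half S M y + half S M z ≤ half S M x' + half S M y' + half S M z'

/-- Greedy choice: `y` is the last admissible start up to `x + M`, and `z` is chosen to cover slice
`y + M`. Maximality of `y` puts `z` beyond `x + M`, so the third half-circle closes the cycle. -/
theorem IsPrefixSum.exists_covers (hS : IsPrefixSum S M T) {p : ℝ}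
    (hp : ∀ v, ∃ i, v - M + 1 ≤ i ∧ i ≤ v ∧ half S M i ≤ p) :
    ∃ x y z, Covers M x y z ∧ half S M x ≤ p ∧ half S M y ≤ p ∧ half S M z ≤ p := by
  have h1 := hS.one_le
  obtain ⟨x, -, -, hx⟩ := hp 0
  obtain ⟨y, ⟨hy1, hy2, hy3⟩, hymax⟩ := Int.exists_greatest_of_bdd
    (P := fun i => x + 1 ≤ i ∧ i ≤ x + M ∧ half S M i ≤ p) ⟨x + M, fun z hz => hz.2.1⟩ (by
      obtain ⟨i, hi1, hi2, hi3⟩ := hp (x + M)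
      exact ⟨i, by omega, hi2, hi3⟩)
  rcases le_or_gt (x + M - 1) y with hle | hlt
  · exact ⟨x, y, y, ⟨by omega, by omega, by omega, by omega, by omega, by omega⟩, hx, hy3, hy3⟩
  · obtain ⟨z, hz1, hz2, hz3⟩ := hp (y + M)
    have hz4 : x + M < z := by
      by_contra hcon
      have := hymax z ⟨by omega, by omega, hz3⟩
      omega
    exact ⟨x, y, z, ⟨by omega, by omega, by omega, by omega, by omega, by omega⟩, hx, hy3, hz3⟩

/-- Translation by a multiple of the period brings every triple into a finite box. -/
theorem IsPrefixSum.exists_minTriple (hS : IsPrefixSum S M T) {p : ℝ}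
    (hp : ∀ v, ∃ i, v - M + 1 ≤ i ∧ i ≤ v ∧ half S M i ≤ p) : ∃ x y z, MinTriple S M p x y z := by
  classical
  have h1 := hS.one_le
  let good : ℤ × ℤ × ℤ → Prop := fun t => Covers M t.1 t.2.1 t.2.2 ∧ half S M t.1 ≤ p ∧
    half S M t.2.1 ≤ p ∧ half S M t.2.2 ≤ p
  let tot : ℤ × ℤ × ℤ → ℝ := fun t => half S M t.1 + half S M t.2.1 + half S M t.2.2
  let box : Finset (ℤ × ℤ × ℤ) := (Finset.Ico 0 (2 * M - 1) ×ˢ Finset.Icc 0 (4 * M) ×ˢ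
    Finset.Icc 0 (4 * M)).filter good
  have hbox : ∀ t, good t → ∃ t' ∈ box, tot t' = tot t := by
    rintro ⟨x, y, z⟩ ⟨hc, hx, hy, hz⟩
    have hw1 := Int.emod_nonneg x (show 2 * M - 1 ≠ 0 by omega)
    have hw2 := Int.emod_lt_of_pos x (show 0 < 2 * M - 1 by omega)
    have hw3 := Int.emod_add_mul_ediv x (2 * M - 1)
    rw [mul_comm (2 * M - 1)] at hw3
    have hper : ∀ i, half S M (i + -(x / (2 * M - 1)) * (2 * M - 1)) = half S M i := fun i =>
      hS.half_add_mul_period i _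
    have hc1 := hc.1
    have hc2 := hc.2
    have hc3 := hc.3
    have hc4 := hc.4
    have hc5 := hc.5
    have hc6 := hc.6
    refine ⟨(x + -(x / (2 * M - 1)) * (2 * M - 1), y + -(x / (2 * M - 1)) * (2 * M - 1),
      z + -(x / (2 * M - 1)) * (2 * M - 1)), ?_, by simp only [tot, hper]⟩
    simp only [box, good, Finset.mem_filter, Finset.mem_product, Finset.mem_Ico, Finset.mem_Icc, hper]
    refine ⟨⟨⟨?_, ?_⟩, ⟨?_, ?_⟩, ?_, ?_⟩, ⟨?_, ?_, ?_, ?_, ?_, ?_⟩, hx, hy, hz⟩ <;> linarith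
  obtain ⟨x, y, z, hc⟩ := hS.exists_covers hp
  obtain ⟨t, ht, -⟩ := hbox (x, y, z) hc
  obtain ⟨⟨x, y, z⟩, hm, hmin⟩ := Finset.exists_min_image box tot ⟨t, ht⟩
  obtain ⟨-, hc, hx, hy, hz⟩ := Finset.mem_filter.1 hm
  refine ⟨x, y, z, hc, hx, hy, hz, fun x' y' z' hc' hx' hy' hz' => ?_⟩
  obtain ⟨t', ht', he⟩ := hbox (x', y', z') ⟨hc', hx', hy', hz'⟩
  have := hmin t' ht'
  rw [he] at this
  exact this

/-- Lets each half-circle of the triple in turn play the role of `x`. -/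
theorem MinTriple.rotate (hS : IsPrefixSum S M T) {p : ℝ} {x y z : ℤ} (h : MinTriple S M p x y z) :
    MinTriple S M p y z (x + (2 * M - 1)) where
  covers := by
    obtain ⟨h1, h2, h3, h4, h5, h6⟩ := h.covers
    exact ⟨h3, h4, h5, h6, by omega, by omega⟩
  hx := h.hy
  hy := h.hz
  hz := by rw [hS.half_add_period]; exact h.hx
  minimal x' y' z' hc h1 h2 h3 := by
    rw [hS.half_add_period]
    have := h.minimal x' y' z' hc h1 h2 h3
    linarith

/-- If two half-circles of a triple cover the cycle, then one of them is at least half of it. -/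
theorem MinTriple.half_le_of_le (hS : IsPrefixSum S M T) {p : ℝ} {x y z : ℤ}
    (h : MinTriple S M p x y z) (hz : z ≤ x + M) : T / 2 ≤ p := by
  have h1 := h.hx
  have h2 := h.hz
  have h3 := h.covers.zx'
  unfold half at h1 h2
  have e1 : S z ≤ S (x + M) := hS.mono hz
  have e2 : S (x + (2 * M - 1)) ≤ S (z + M) := hS.mono h3
  rw [hS.add_period] at e2
  linarith

/-- Otherwise the half-circle at `i` could replace the one at `y` (if `i ≤ x + M`) or at `z` (if `x
+ M ≤ i`), giving a covering triple of smaller total. -/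
theorem MinTriple.le_half (hS : IsPrefixSum S M T) {p : ℝ} {x y z : ℤ} (h : MinTriple S M p x y z)
    (hz : x + M ≤ z) {i : ℤ} (h1 : z - M ≤ i) (h2 : i ≤ y + M) (hy : y + 1 ≤ x + M) :
    min (half S M y) (half S M z) ≤ half S M i := by
  have hM := hS.one_le
  obtain ⟨c1, c2, c3, c4, c5, c6⟩ := h.covers
  by_contra hcon
  rw [min_le_iff, not_or] at hcon
  push Not at hcon
  have hip : half S M i ≤ p := hcon.1.le.trans h.hy
  rcases le_total i (x + M) with h3 | h3
  · have := h.minimal x i z ⟨by omega, by omega, by omega, by omega, by omega, by omega⟩ h.hx hip h.hz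
    linarith
  · have := h.minimal x y i ⟨by omega, by omega, by omega, by omega, by omega, by omega⟩ h.hx h.hy hip
    linarith

end Pizza

/-! ### Lower bounds for odd `n` -/

namespace Pizza

variable {S : ℤ → ℝ} {M : ℤ} {T : ℝ}

/-- `[z - M + 1, y)` is covered only by the half-circle at `x`, and the opposite arc `[z, y + M)` is
the overlap of the other two. -/
theorem MinTriple.secures_two_jumps (hS : IsPrefixSum S M T) {p : ℝ} {x y z : ℤ}
    (h : MinTriple S M p x y z) (hp : Secures S M 2 p) (hxz : x + M < z) (hyx : y + 1 < x + M)
    (hzy : z + 1 < y + M) :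
    Secures S M 2 (min (half S M y) (half S M z) + (S y - S (z - M + 1)) / 2 -
      3 / 4 * (S (y + M) - S z)) := by
  rcases le_or_gt (min (half S M y) (half S M z) + (S y - S (z - M + 1)) / 2 -
      3 / 4 * (S (y + M) - S z)) (min (half S M y) (half S M z)) with hle | hlt
  · exact hp.mono (hle.trans ((min_le_left _ _).trans h.hy))
  · refine hS.secures_two_jumps (X := z - M + 1) (Y := y) (by omega) (by omega)
      (fun i h1 h2 => h.le_half hS hxz.le (by omega) (by omega) (by omega)) ?_ hlt
    rw [show z - M + 1 + M - 1 = z by ring]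

/-- The arc covered only from `x` is the single slice `y - 1`. Alice starts there and must leave at
once; she gets at least its size plus the smaller of the other two half-circles minus their overlap,
which is `T` minus the larger one. -/
theorem MinTriple.secures_one_jump (hS : IsPrefixSum S M T) {p : ℝ} {x y z : ℤ}
    (h : MinTriple S M p x y z) (hp : p < T / 2) (hxz : x + M < z) (hyx : y + 1 < x + M)
    (hzy : z + 2 = y + M) : Secures S M 1 (T / 2) := by
  have hzp : S (z + M) = S (y - 1) + T := by
    rw [← hS.add_period]; congr 1; omega
  have h2 := h.hy
  have h3 := h.hz
  have key : T / 2 ≤ S y - S (y - 1) + min (half S M y) (half S M z) - (S (y + M) - S z) := by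
    rcases min_choice (half S M y) (half S M z) with hm | hm <;> rw [hm] <;>
      unfold half at h2 h3 ⊢ <;> linarith
  refine hS.secures_of_exits (X := y - 1) (Y := y) (v := y - 1) 0 (by have := h.covers.zx'; omega) le_rfl
    (by omega) (fun i h1 h2 => h.le_half hS hxz.le (by omega) (by omega) (by omega)) ?_ ?_
  · intro t ht1 ht2
    obtain rfl : t = y := by omega
    have e1 : S (t + M - 1) ≤ S (t + M) := hS.mono (by omega)
    rw [show t - 1 + M - 1 = z by omega]
    linarith
  · intro t ht1 ht2
    obtain rfl : t = y - 1 := by omega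
    have e1 : S z ≤ S (y - 1 + M) := hS.mono (by omega)
    linarith

/-- If `p < T / 2`, each of the three once-covered arcs has at least one slice and each overlap at
least two: 9 slices, against `2 * M - 1 ≤ 7`. -/
theorem IsPrefixSum.secures_half_of_le_four (hS : IsPrefixSum S M T) (hM : M ≤ 4) :
    Secures S M 0 (T / 2) := by
  obtain ⟨p, ⟨v, hv⟩, hp⟩ := hS.exists_potential
  obtain ⟨x, y, z, h⟩ := hS.exists_minTriple hp
  have hsec := hS.secures_of_le_half 0 hv
  by_contra hcon
  have hpT : p < T / 2 := lt_of_not_ge fun hle => hcon (hsec.mono hle)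
  have d1 : ¬ z ≤ x + M := fun hle => not_le.2 hpT (h.half_le_of_le hS hle)
  have d2 : ¬ x + (2 * M - 1) ≤ y + M := fun hle =>
    not_le.2 hpT ((h.rotate hS).half_le_of_le hS hle)
  have d3 : ¬ y + (2 * M - 1) ≤ z + M := fun hle =>
    not_le.2 hpT (((h.rotate hS).rotate hS).half_le_of_le hS hle)
  omega

/-- Overlaps of two slices are now excluded as well, so a failure needs 3 · 2 + 3 · 3 = 15 slices,
against `2 * M - 1 ≤ 13`. -/
theorem IsPrefixSum.secures_half_of_le_seven (hS : IsPrefixSum S M T) (hM : M ≤ 7) :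
    Secures S M 1 (T / 2) := by
  obtain ⟨p, ⟨v, hv⟩, hp⟩ := hS.exists_potential
  obtain ⟨x, y, z, h⟩ := hS.exists_minTriple hp
  have hsec := hS.secures_of_le_half 1 hv
  by_contra hcon
  have hpT : p < T / 2 := lt_of_not_ge fun hle => hcon (hsec.mono hle)
  have h' := h.rotate hS
  have h'' := h'.rotate hS
  have d1 : ¬ z ≤ x + M := fun hle => not_le.2 hpT (h.half_le_of_le hS hle)
  have d2 : ¬ x + (2 * M - 1) ≤ y + M := fun hle => not_le.2 hpT (h'.half_le_of_le hS hle)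
  have d3 : ¬ y + (2 * M - 1) ≤ z + M := fun hle => not_le.2 hpT (h''.half_le_of_le hS hle)
  have e1 : z + 2 ≠ y + M := fun he =>
    hcon (h.secures_one_jump hS hpT (by omega) (by omega) he)
  have e2 : x + (2 * M - 1) + 2 ≠ z + M := fun he =>
    hcon (h'.secures_one_jump hS hpT (by omega) (by omega) he)
  have e3 : y + (2 * M - 1) + 2 ≠ x + (2 * M - 1) + M := fun he =>
    hcon (h''.secures_one_jump hS hpT (by omega) (by omega) he)
  omega

theorem IsPrefixSum.secures_four_ninths (hS : IsPrefixSum S M T) : Secures S M 2 (4 / 9 * T) := by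
  obtain ⟨p, ⟨v, hv⟩, hp⟩ := hS.exists_potential
  obtain ⟨x, y, z, h⟩ := hS.exists_minTriple hp
  have hsec := hS.secures_of_le_half 2 hv
  by_contra hcon
  have hno : ∀ {c}, Secures S M 2 c → c < 4 / 9 * T := fun hc =>
    lt_of_not_ge fun hle => hcon (hc.mono hle)
  have hpT := hno hsec
  have hT : 0 ≤ T := by
    have e1 := hS.add_period 0
    have e2 : S 0 ≤ S (0 + (2 * M - 1)) := hS.mono (by have := hS.one_le; omega)
    linarith
  have hpT' : p < T / 2 := by linarith
  have h' := h.rotate hS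
  have h'' := h'.rotate hS
  have d1 : ¬ z ≤ x + M := fun hle => not_le.2 hpT' (h.half_le_of_le hS hle)
  have d2 : ¬ x + (2 * M - 1) ≤ y + M := fun hle => not_le.2 hpT' (h'.half_le_of_le hS hle)
  have d3 : ¬ y + (2 * M - 1) ≤ z + M := fun hle => not_le.2 hpT' (h''.half_le_of_le hS hle)
  have g1 := hno (h.secures_two_jumps hS hsec (by omega) (by omega) (by omega))
  have g2 := hno (h'.secures_two_jumps hS hsec (by omega) (by omega) (by omega))
  have g3 := hno (h''.secures_two_jumps hS hsec (by omega) (by omega) (by omega))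
  simp only [hS.half_add_period] at g2 g3
  rw [show x + (2 * M - 1) - M + 1 = x + M by ring] at g2
  rw [show y + (2 * M - 1) - M + 1 = y + M by ring,
    show x + (2 * M - 1) + M = x + M + (2 * M - 1) by ring] at g3
  simp only [hS.add_period] at g2 g3
  have hz : S (z + M) = S (z - M + 1) + T := by
    rw [← hS.add_period]; congr 1; ring
  have m1 : S x ≤ S (z - M + 1) := hS.mono (by omega)
  have m2 : S (z - M + 1) ≤ S y := hS.mono (by omega)
  have m3 : S y ≤ S (x + M) := hS.mono (by omega)
  have m4 : S (x + M) ≤ S z := hS.mono (by omega)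
  have m5 : S z ≤ S (y + M) := hS.mono (by omega)
  have m6 : S (y + M) ≤ S x + T := by
    rw [← hS.add_period]; exact hS.mono (by omega)
  have h1 := h.hx
  have h2 := h.hy
  have h3 := h.hz
  -- Sort the half-circles as `h₁ ≤ h₂ ≤ h₃`. Twice the two-jump bound for the pair 2, 3, plus the
  -- one for 1, 2, plus `3/2 h₃`, equals `2T` plus half the overlap of 1, 3 and a quarter of that of
  -- 1, 2. The weights sum to 9/2, so one term is at least `4/9 T`.
  rcases le_total (half S M x) (half S M y) with i1 | i1 <;>
  rcases le_total (half S M y) (half S M z) with i2 | i2 <;>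
  rcases le_total (half S M z) (half S M x) with i3 | i3 <;>
  simp only [min_eq_left, min_eq_right, i1, i2, i3] at g1 g2 g3 <;>
  unfold half at * <;> linarith

end Pizza

/-! ### From the characteristic cycle to the pizza; even `n` -/

namespace Pizza

/-- Index `i` stands for slice `2 i` modulo `2 M - 1`. Since `2 (u + M - 1) = 2 u - 1 + (2 M - 1)`,
the neighbour `lo - 1` has index `u + M - 1`. -/
theorem Gains.collects {w : ℤ → ℝ} {S : ℤ → ℝ} {M : ℤ}
    (hw : ∀ i j : ℤ, (2 * M - 1) ∣ i - j → w i = w j) (hS : ∀ i, S (i + 1) = S i + w (2 * i)) :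
    ∀ (r : ℕ) (u lo hi : ℤ) (J : ℕ) (c : ℝ), Gains S M r u J c → (2 * M - 1) ∣ lo - 2 * u →
      hi = lo + (2 * M - 1) - 2 * r → Collects w (2 * r) lo hi J c := by
  intro r
  induction r with
  | zero => intro u lo hi J c h _ _; exact h
  | succ r ih =>
    intro u lo hi J c h hd hhi
    obtain ⟨t, ht⟩ := hd
    push_cast at hhi
    have hq : ∀ i j k s : ℤ, k = i + 1 → j - 2 * i = (2 * M - 1) * s → w j = S k - S i := by
      intro i j k s hk hs
      rw [hk, hS, hw j (2 * i) ⟨s, hs⟩]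
      ring
    have w1 : w (lo - 2) = S u - S (u - 1) := hq _ _ _ t (by ring) (by linarith)
    have w2 : w hi = S (u + 2 * M - r - 1) - S (u + 2 * M - r - 2) :=
      hq _ _ _ (t - 1) (by ring) (by linear_combination ht + hhi)
    have w3 : w (hi + 1) = S (u + M - r) - S (u + M - r - 1) :=
      hq _ _ _ t (by ring) (by rw [← ht, hhi]; ring)
    have w4 : w (lo - 1) = S (u + M) - S (u + M - 1) :=
      hq _ _ _ (t - 1) (by ring) (by linear_combination ht)
    have hjump : (2 * M - 1) ∣ lo - 1 - 2 * (u + M - 1) := ⟨t - 1, by linear_combination ht⟩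
    show Collects w (2 * r + 2) lo hi J c
    unfold Collects
    rw [w1, w2, w3, w4]
    refine ⟨h.1.imp (fun hk => ih _ _ _ _ _ hk ⟨t, by rw [← ht]; ring⟩ (by rw [hhi]; ring)) ?_,
      h.2.imp (fun hk => ih _ _ _ _ _ hk ⟨t, by rw [← ht]⟩ (by rw [hhi]; ring)) ?_⟩ <;>
    · rintro ⟨J', rfl, hk⟩
      exact ⟨J', rfl, ih _ _ _ _ _ hk hjump (by rw [hhi]; ring)⟩

theorem exists_sum_function (q : ℤ → ℝ) : ∃ S : ℤ → ℝ, S 0 = 0 ∧ ∀ i, S (i + 1) = S i + q i := by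
  refine ⟨fun i => ∑ t ∈ Finset.Ico 0 i, q t - ∑ t ∈ Finset.Ico i 0, q t, by simp, fun i => ?_⟩
  rcases le_or_gt 0 i with hi | hi
  · have h1 : Finset.Ico (0 : ℤ) (i + 1) = insert i (Finset.Ico 0 i) := by
      ext t; simp only [Finset.mem_Ico, Finset.mem_insert]; omega
    have h2 : Finset.Ico (i + 1) (0 : ℤ) = ∅ := Finset.Ico_eq_empty (by omega)
    have h3 : Finset.Ico i (0 : ℤ) = ∅ := Finset.Ico_eq_empty (by omega)
    simp only [h1, h2, h3]
    rw [Finset.sum_insert (by simp)]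
    simp; ring
  · have h1 : Finset.Ico i (0 : ℤ) = insert i (Finset.Ico (i + 1) 0) := by
      ext t; simp only [Finset.mem_Ico, Finset.mem_insert]; omega
    have h2 : Finset.Ico (0 : ℤ) (i + 1) = ∅ := Finset.Ico_eq_empty (by omega)
    have h3 : Finset.Ico (0 : ℤ) i = ∅ := Finset.Ico_eq_empty (by omega)
    simp only [h1, h2, h3]
    rw [Finset.sum_insert (by simp)]
    simp

theorem sum_range_natCast {n : ℕ} [NeZero n] (f : ZMod n → ℝ) :
    ∑ t ∈ Finset.range n, f (t : ZMod n) = ∑ s, f s := by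
  refine Finset.sum_bij' (fun t _ => (t : ZMod n)) (fun s _ => s.val) ?_ ?_ ?_ ?_ ?_
  · simp
  · intro s _; exact Finset.mem_range.2 s.val_lt
  · intro t ht; exact ZMod.val_cast_of_lt (Finset.mem_range.1 ht)
  · intro s _; exact ZMod.natCast_zmod_val s
  · simp

theorem sum_function_add {S q : ℤ → ℝ} (hS : ∀ i, S (i + 1) = S i + q i) (i : ℤ) (k : ℕ) :
    S (i + k) = S i + ∑ t ∈ Finset.range k, q (i + t) := by
  induction k with
  | zero => simp
  | succ k ih => rw [Finset.sum_range_succ, ← add_assoc, ← ih, ← hS]; push_cast; congr 1; ring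

/-- The prefix sums along the characteristic cycle. -/
theorem exists_isPrefixSum {n : ℕ} [NeZero n] {M : ℤ} (hn : (n : ℤ) = 2 * M - 1) {p : ZMod n → ℝ}
    (hp : ∀ i, 0 ≤ p i) : ∃ S, IsPrefixSum S M (size p) ∧
      ∀ i : ℤ, S (i + 1) = S i + p ((2 * i : ℤ) : ZMod n) := by
  obtain ⟨S, h0, hS⟩ := exists_sum_function fun i => p ((2 * i : ℤ) : ZMod n)
  refine ⟨S, ⟨?_, ?_, ?_⟩, hS⟩
  · have := Nat.pos_of_ne_zero (NeZero.ne n)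
    omega
  · exact monotone_int_of_le_succ fun i => by rw [hS]; linarith [hp ((2 * i : ℤ) : ZMod n)]
  · intro i
    have hcop : Nat.Coprime 2 n := by
      rw [Nat.coprime_two_left, ← Int.odd_coe_nat, hn]
      exact ⟨M - 1, by ring⟩
    -- Doubling is a bijection because `n` is odd, so one period of `S` counts each slice once.
    let e : ZMod n ≃ ZMod n := (Units.mulLeft (ZMod.unitOfCoprime 2 hcop)).trans (Equiv.refl _)
    rw [← hn, sum_function_add hS]
    congr 1
    rw [size, ← ((Equiv.addLeft (i : ZMod n)).trans e).sum_comp p, ← sum_range_natCast]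
    refine Finset.sum_congr rfl fun t _ => ?_
    congr 1
    simp [e]

theorem Secures.exists_strategy {n : ℕ} [NeZero n] {M : ℤ} (hn : (n : ℤ) = 2 * M - 1)
    {p : ZMod n → ℝ} {S : ℤ → ℝ} (hS : ∀ i : ℤ, S (i + 1) = S i + p ((2 * i : ℤ) : ZMod n)) {J : ℕ}
    {c : ℝ} (h : Secures S M J c) :
    ∃ σ : AliceStrategy n, IsJumpStrategy J σ ∧ HasGain σ p c := by
  obtain ⟨v, hv⟩ := h
  have hnp := Nat.pos_of_ne_zero (NeZero.ne n)
  have hc := hv.collects (w := fun i => p (i : ZMod n)) ?_ hS _ _ (2 * v) (2 * v + 1) J _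
    (by simp) (by omega)
  · rw [show 2 * (M - 1).toNat = n - 1 by omega] at hc
    refine Collects.exists_strategy (v := 2 * v) ?_
    rw [hS] at hc
    convert hc using 1
    ring
  · intro i j hij
    have : (i : ZMod n) = (j : ZMod n) := by
      rw [eq_comm, ZMod.intCast_eq_intCast_iff_dvd_sub, hn]
      exact hij
    simp only [this]

/-- The sum of `w` over `k` slices at distance two, starting at `x`. -/
def altSum (w : ℤ → ℝ) (x : ℤ) (k : ℕ) : ℝ := ∑ t ∈ Finset.range k, w (x + 2 * t)

theorem altSum_succ (w : ℤ → ℝ) (x : ℤ) (k : ℕ) :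
    altSum w x (k + 1) = altSum w x k + w (x + 2 * k) :=
  Finset.sum_range_succ _ _

theorem altSum_succ' (w : ℤ → ℝ) (x : ℤ) (k : ℕ) :
    altSum w x (k + 1) = w x + altSum w (x + 2) k := by
  unfold altSum
  rw [Finset.sum_range_succ', add_comm]
  congr 1
  · simp
  · refine Finset.sum_congr rfl fun t _ => ?_
    congr 1; push_cast; ring

/-- With an odd number of slices left, the shift after either turn of Bob takes an end of the class
`hi + 1, hi + 3, …`. -/
theorem collects_of_even {n : ℕ} (p : ZMod n → ℝ) (J : ℕ) : ∀ (r : ℕ) (lo hi : ℤ) (c : ℝ),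
    lo + n = hi + (2 * r + 1) → c ≤ altSum (fun i => p (i : ZMod n)) (hi + 1) r →
    Collects (fun i => p (i : ZMod n)) (2 * r + 1) lo hi J c := by
  intro r
  induction r with
  | zero => intro lo hi c _ h; simpa [altSum, Collects] using h
  | succ r ih =>
    intro lo hi c hlo h
    show Collects (fun i => p (i : ZMod n)) (2 * r + 1 + 2) lo hi J c
    unfold Collects
    push_cast at hlo
    refine ⟨Or.inl (ih _ _ _ (by linarith) ?_), Or.inl (ih _ _ _ (by linarith) ?_)⟩
    · have : (((lo - 2 : ℤ)) : ZMod n) = ((hi + 1 + 2 * r : ℤ) : ZMod n) := by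
        rw [ZMod.intCast_eq_intCast_iff_dvd_sub]
        exact ⟨1, by linarith⟩
      rw [altSum_succ] at h
      simp only [this]
      linarith
    · rw [altSum_succ'] at h
      rw [show hi + 2 + 1 = hi + 1 + 2 by ring]
      linarith

theorem altSum_add_altSum (w : ℤ → ℝ) (x : ℤ) (k : ℕ) :
    altSum w x k + altSum w (x + 1) k = ∑ t ∈ Finset.range (2 * k), w (x + t) := by
  induction k with
  | zero => simp [altSum]
  | succ k ih =>
    rw [altSum_succ, altSum_succ, show 2 * (k + 1) = 2 * k + 1 + 1 by ring, Finset.sum_range_succ,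
      Finset.sum_range_succ, ← ih]
    push_cast
    rw [show x + 1 + 2 * (k : ℤ) = x + (2 * k + 1) by ring]
    ring

theorem exists_strategy_of_even {n : ℕ} [NeZero n] (hn : Even n) (p : ZMod n → ℝ) :
    ∃ σ : AliceStrategy n, IsJumpStrategy 0 σ ∧ HasGain σ p (1 / 2 * size p) := by
  obtain ⟨k, hk⟩ := hn
  have hnp := Nat.pos_of_ne_zero (NeZero.ne n)
  obtain ⟨r, rfl⟩ : ∃ r, k = r + 1 := ⟨k - 1, by omega⟩
  have key : ∀ v : ℤ, 1 / 2 * size p ≤ altSum (fun i => p (i : ZMod n)) v (r + 1) →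
      ∃ σ : AliceStrategy n, IsJumpStrategy 0 σ ∧ HasGain σ p (1 / 2 * size p) := by
    intro v hv
    refine Collects.exists_strategy (v := v) ?_
    rw [show n - 1 = 2 * r + 1 by omega]
    refine collects_of_even p 0 r _ _ _ (by rw [hk]; push_cast; ring) ?_
    rw [altSum_succ'] at hv
    rw [show v + 1 + 1 = v + 2 by ring]
    linarith
  have hsum := altSum_add_altSum (fun i => p (i : ZMod n)) 0 (r + 1)
  rw [show 2 * (r + 1) = n by omega] at hsum
  have hs : ∑ t ∈ Finset.range n, p (((0 + t : ℤ)) : ZMod n) = size p := by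
    rw [size, ← sum_range_natCast]
    simp
  rw [hs, zero_add] at hsum
  rcases le_total (1 / 2 * size p) (altSum (fun i => p (i : ZMod n)) 0 (r + 1)) with h | h
  · exact key 0 h
  · exact key 1 (by linarith)

end Pizza

/-! ### Bob's parity strategy and the hard cutting -/

namespace Pizza

theorem Restricts.alice_turn {w : ℤ → ℝ} {r : ℕ} {x : ℤ} {c : ℝ} (y : ℤ)
    (hl : Restricts w r false (x + 1) (c - w x)) (hy : x + r = y)
    (hr : Restricts w r false x (c - w y)) : Restricts w (r + 1) true x c := by
  subst hy
  exact ⟨hl, hr⟩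

theorem Restricts.bob_first {w : ℤ → ℝ} {r : ℕ} {x : ℤ} {c : ℝ}
    (h : Restricts w r true (x + 1) c) : Restricts w (r + 1) false x c := Or.inl h

theorem Restricts.bob_last {w : ℤ → ℝ} {r : ℕ} {x : ℤ} {c : ℝ}
    (h : Restricts w r true x c) : Restricts w (r + 1) false x c := Or.inr h

/-- When an even number of slices remain on Bob's turn, he can take all slices of either parity. -/
theorem restricts_of_altSum_le {w : ℤ → ℝ} : ∀ (k : ℕ) (x : ℤ) (c : ℝ),
    (altSum w x k ≤ c ∨ altSum w (x + 1) k ≤ c) → Restricts w (2 * k) false x c := by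
  intro k
  induction k with
  | zero => intro x c h; simpa [altSum, Restricts] using h
  | succ k ih =>
    intro x c h
    show Restricts w (2 * k + 1 + 1) false x c
    rcases h with h | h
    · refine Restricts.bob_last (Restricts.alice_turn (x + 2 * k) (ih _ _ (Or.inr ?_)) (by push_cast; ring)
        (ih _ _ (Or.inl ?_)))
      · rw [altSum_succ'] at h
        rw [show x + 1 + 1 = x + 2 by ring]
        linarith
      · rw [altSum_succ] at h
        linarith
    · refine Restricts.bob_first (Restricts.alice_turn (x + 1 + 2 * k) (ih _ _ (Or.inr ?_))
        (by push_cast; ring) (ih _ _ (Or.inl ?_)))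
      · rw [altSum_succ'] at h
        rw [show x + 1 + 1 + 1 = x + 1 + 2 by ring]
        linarith
      · rw [altSum_succ] at h
        linarith

theorem altSum_eq_sub {w F : ℤ → ℝ} {x : ℤ} {k : ℕ}
    (hF : ∀ t : ℕ, t < k → F (x + 2 * t + 2) = F (x + 2 * t) + w (x + 2 * t)) :
    altSum w x k = F (x + 2 * k) - F x := by
  induction k with
  | zero => simp [altSum]
  | succ k ih =>
    rw [altSum_succ, ih fun t ht => hF t (by omega)]
    have := hF k (by omega)
    push_cast
    rw [show x + 2 * ((k : ℤ) + 1) = x + 2 * k + 2 by ring, this]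
    ring

/-- Bob leaves to Alice only slices with indices congruent to `e` modulo two, whose sizes have the partial
sums `F`. -/
theorem restricts_of_parity {w F : ℤ → ℝ} {B e x : ℤ} {r : ℕ} {c : ℝ} (he : e = 0 ∨ e = 1)
    (hF : ∀ i, 0 ≤ i → i < B → i % 2 = e → F (i + 2) = F i + w i)
    (hF' : ∀ i, i % 2 ≠ e → F (i + 1) = F i) (hr : Even r) (hx : 0 ≤ x) (hB : x + r ≤ B)
    (hc : F (x + r) - F x ≤ c) : Restricts w r false x c := by
  obtain ⟨k, rfl⟩ := hr
  rw [← two_mul] at *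
  push_cast at *
  refine restricts_of_altSum_le k x c ?_
  by_cases hp : x % 2 = e
  · left
    rw [altSum_eq_sub (F := F) fun t ht => hF _ (by omega) (by omega) (by omega)]
    exact hc
  · right
    rw [altSum_eq_sub (F := F) fun t ht => hF _ (by omega) (by omega) (by omega), hF' x hp,
      show x + 1 + 2 * (k : ℤ) = x + 2 * k + 1 by ring, hF' _ (by omega)]
    exact hc

theorem cutting_intCast {n : ℕ} {L : List ℝ} {i : ℤ} {t : ℕ} (ht : t < n) (hi : (n : ℤ) ∣ i - t) :
    cutting n L (i : ZMod n) = L.getD t 0 := by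
  have : (i : ZMod n) = ((t : ℕ) : ZMod n) := by
    rw [← Int.cast_natCast, eq_comm, ZMod.intCast_eq_intCast_iff_dvd_sub]
    exact hi
  rw [cutting, this, ZMod.val_cast_of_lt ht]

theorem size_cutting {n : ℕ} [NeZero n] (L : List ℝ) (hL : L.length ≤ n) :
    size (cutting n L) = L.sum := by
  rw [size, ← sum_range_natCast]
  have h1 : ∑ t ∈ Finset.range n, cutting n L (t : ZMod n) = ∑ t ∈ Finset.range n, L.getD t 0 :=
    Finset.sum_congr rfl fun t ht => by
      rw [cutting, ZMod.val_cast_of_lt (Finset.mem_range.1 ht)]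
  rw [h1]
  clear h1
  induction L generalizing n with
  | nil => simp
  | cons a L ih =>
    obtain ⟨k, rfl⟩ : ∃ k, n = k + 1 := ⟨n - 1, by simp at hL; omega⟩
    rw [Finset.sum_range_succ', List.sum_cons, add_comm]
    simp only [List.getD_cons_succ, List.getD_cons_zero]
    congr 1
    rcases Nat.eq_zero_or_pos k with rfl | hk
    · have : L = [] := by simpa using hL
      simp [this]
    · have : NeZero k := ⟨by omega⟩
      exact ih (by simpa using hL)

/-- The indicator function of `a < i`. -/
noncomputable def step (a i : ℤ) : ℝ := if a < i then 1 else 0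

theorem step_of_lt {a i : ℤ} (h : a < i) : step a i = 1 := if_pos h

theorem step_of_le {a i : ℤ} (h : i ≤ a) : step a i = 0 := if_neg (by omega)

theorem step_succ {a i : ℤ} (h : i ≠ a) : step a (i + 1) = step a i := by
  unfold step
  congr 1
  apply propext
  omega

theorem step_add_two {a i : ℤ} (h : i % 2 = a % 2) :
    step a (i + 2) = step a i + if i = a then 1 else 0 := by
  unfold step
  by_cases h1 : i = a
  · subst h1; simp
  · rw [if_neg h1, add_zero]
    congr 1
    apply propext
    omega

/-- Partial sums over the odd indices in `[0, 2 n)` for the cutting with sizes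
`0, 0, 2, 0, 2, 0, 0, 3, 0, 3, 0, 0, 4, 0, 4`. -/
noncomputable def oddSum (n i : ℤ) : ℝ :=
  3 * step 7 i + 3 * step 9 i + 2 * step (n + 2) i + 2 * step (n + 4) i + 4 * step (n + 12) i +
    4 * step (n + 14) i

/-- Partial sums over the even indices in `[0, 2 n)` for the cutting with sizes
`0, 0, 2, 0, 2, 0, 0, 3, 0, 3, 0, 0, 4, 0, 4`. -/
noncomputable def evenSum (n i : ℤ) : ℝ :=
  2 * step 2 i + 2 * step 4 i + 4 * step 12 i + 4 * step 14 i + 3 * step (n + 7) i +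
    3 * step (n + 9) i

/-- The sizes, as a function of an integer index, of the cutting on which Bob does best. -/
noncomputable def hardSize (n : ℕ) (i : ℤ) : ℝ :=
  cutting n [0, 0, 2, 0, 2, 0, 0, 3, 0, 3, 0, 0, 4, 0, 4] (i : ZMod n)

/-- After a start at `v` the interval `[v + 1, v + n)` remains, so two periods suffice; `n` being
odd, the second one swaps parities. -/
theorem hardSize_eq {n : ℕ} (hn : 15 ≤ n) {i : ℤ} (h0 : 0 ≤ i) (h1 : i < 2 * n) :
    hardSize n i = ((2 * if i = 2 then 1 else 0) + (2 * if i = 4 then 1 else 0) +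
      (3 * if i = 7 then 1 else 0) + (3 * if i = 9 then 1 else 0) + (4 * if i = 12 then 1 else 0) +
      (4 * if i = 14 then 1 else 0)) + ((2 * if i = n + 2 then 1 else 0) +
      (2 * if i = n + 4 then 1 else 0) + (3 * if i = n + 7 then 1 else 0) +
      (3 * if i = n + 9 then 1 else 0) + (4 * if i = n + 12 then 1 else 0) +
      (4 * if i = n + 14 then 1 else 0)) := by
  have key : ∀ t : ℕ, [0, 0, 2, 0, 2, 0, 0, 3, 0, 3, 0, 0, 4, 0, 4].getD t (0 : ℝ) =
      (2 * if t = 2 then 1 else 0) + (2 * if t = 4 then 1 else 0) +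
      (3 * if t = 7 then 1 else 0) + (3 * if t = 9 then 1 else 0) + (4 * if t = 12 then 1 else 0) +
      (4 * if t = 14 then 1 else 0) := by
    intro t
    rcases lt_or_ge t 15 with ht | ht
    · interval_cases t <;> norm_num
    · rw [List.getD_eq_default _ _ (by simpa using ht)]
      simp (disch := omega) only [if_neg]
      norm_num
  rcases lt_or_ge i n with hi | hi
  · lift i to ℕ using h0
    rw [hardSize, cutting_intCast (t := i) (by omega) (by simp), key]
    have hne : ∀ a : ℤ, 0 ≤ a → ¬ (i : ℤ) = n + a := fun a ha => by omega
    simp only [hne 2 (by norm_num), hne 4 (by norm_num), hne 7 (by norm_num), hne 9 (by norm_num),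
      hne 12 (by norm_num), hne 14 (by norm_num)]
    norm_cast
  · obtain ⟨j, rfl⟩ : ∃ j : ℕ, i = n + j := ⟨(i - n).toNat, by omega⟩
    rw [hardSize, cutting_intCast (t := j) (by omega) (by simp), key]
    have hne : ∀ a : ℤ, a < 15 → ¬ (n : ℤ) + j = a := fun a ha => by omega
    simp only [hne 2 (by norm_num), hne 4 (by norm_num), hne 7 (by norm_num), hne 9 (by norm_num),
      hne 12 (by norm_num), hne 14 (by norm_num), add_right_inj]
    norm_cast
    simp

end Pizza

/-! ### Bob's play on the hard cutting -/

namespace Pizza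

theorem oddSum_add_two {n : ℕ} (hn : 15 ≤ n) (ho : Odd n) {i : ℤ} (h0 : 0 ≤ i) (h1 : i < 2 * n)
    (h2 : i % 2 = 1) : oddSum n (i + 2) = oddSum n i + hardSize n i := by
  obtain ⟨k, hk⟩ := ho
  rw [hardSize_eq hn h0 h1]
  unfold oddSum
  rw [step_add_two (a := 7) (by omega), step_add_two (a := 9) (by omega),
    step_add_two (a := n + 2) (by omega), step_add_two (a := n + 4) (by omega),
    step_add_two (a := n + 12) (by omega), step_add_two (a := n + 14) (by omega),
    if_neg (show ¬ i = 2 by omega), if_neg (show ¬ i = 4 by omega), if_neg (show ¬ i = 12 by omega),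
    if_neg (show ¬ i = 14 by omega), if_neg (show ¬ i = n + 7 by omega),
    if_neg (show ¬ i = n + 9 by omega)]
  ring

theorem evenSum_add_two {n : ℕ} (hn : 15 ≤ n) (ho : Odd n) {i : ℤ} (h0 : 0 ≤ i) (h1 : i < 2 * n)
    (h2 : i % 2 = 0) : evenSum n (i + 2) = evenSum n i + hardSize n i := by
  obtain ⟨k, hk⟩ := ho
  rw [hardSize_eq hn h0 h1]
  unfold evenSum
  rw [step_add_two (a := 2) (by omega), step_add_two (a := 4) (by omega),
    step_add_two (a := 12) (by omega), step_add_two (a := 14) (by omega),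
    step_add_two (a := n + 7) (by omega), step_add_two (a := n + 9) (by omega),
    if_neg (show ¬ i = 7 by omega), if_neg (show ¬ i = 9 by omega), if_neg (show ¬ i = n + 2 by omega),
    if_neg (show ¬ i = n + 4 by omega), if_neg (show ¬ i = n + 12 by omega),
    if_neg (show ¬ i = n + 14 by omega)]
  ring

theorem restricts_odd {n : ℕ} (hn : 15 ≤ n) (ho : Odd n) {x y : ℤ} {r : ℕ} {c : ℝ} (hr : Even r)
    (hx : 0 ≤ x) (hy : x + r = y) (hB : y ≤ 2 * n) (hc : oddSum n y - oddSum n x ≤ c) :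
    Restricts (hardSize n) r false x c := by
  subst hy
  refine restricts_of_parity (F := oddSum n) (B := 2 * n) (Or.inr rfl)
    (fun i h0 h1 h2 => oddSum_add_two hn ho h0 h1 h2) (fun i hi => ?_) hr hx hB hc
  obtain ⟨k, hk⟩ := ho
  unfold oddSum
  rw [step_succ, step_succ, step_succ, step_succ, step_succ, step_succ] <;> omega

theorem restricts_even {n : ℕ} (hn : 15 ≤ n) (ho : Odd n) {x y : ℤ} {r : ℕ} {c : ℝ} (hr : Even r)
    (hx : 0 ≤ x) (hy : x + r = y) (hB : y ≤ 2 * n) (hc : evenSum n y - evenSum n x ≤ c) :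
    Restricts (hardSize n) r false x c := by
  subst hy
  refine restricts_of_parity (F := evenSum n) (B := 2 * n) (Or.inl rfl)
    (fun i h0 h1 h2 => evenSum_add_two hn ho h0 h1 h2) (fun i hi => ?_) hr hx hB hc
  obtain ⟨k, hk⟩ := ho
  unfold evenSum
  rw [step_succ, step_succ, step_succ, step_succ, step_succ, step_succ] <;> omega

theorem hardSize_eq_zero {n : ℕ} (hn : 15 ≤ n) {i : ℤ} (h0 : 0 ≤ i) (h1 : i < 2 * n)
    (h2 : ∀ a ∈ [(2 : ℤ), 4, 7, 9, 12, 14], i ≠ a ∧ i ≠ n + a) : hardSize n i = 0 := by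
  rw [hardSize_eq hn h0 h1]
  simp only [List.mem_cons, List.not_mem_nil, or_false, forall_eq_or_imp, forall_eq] at h2
  simp [h2]

/-- Alice starts at slice `4`. -/
theorem restricts_start_four {n : ℕ} (hn : 15 ≤ n) (ho : Odd n) :
    Restricts (hardSize n) (n - 1) false 5 6 := by
  obtain ⟨k, hk⟩ : ∃ k, n = 2 * k + 15 := ⟨(n - 15) / 2, by obtain ⟨t, ht⟩ := ho; omega⟩
  have hz : ∀ i : ℤ, i = 6 ∨ i = 8 ∨ i = n + 3 ∨ i = n + 1 → hardSize n i = 0 := by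
    intro i hi
    refine hardSize_eq_zero hn (by omega) (by omega) ?_
    simp only [List.mem_cons, List.not_mem_nil, or_false, forall_eq_or_imp, forall_eq]
    omega
  rw [show n - 1 = 2 * k + 14 by omega]
  -- Bob takes the zero slice 5. Alice can only take a zero: after 6 he takes 7, after 3 he takes 2.
  -- The odd class then leaves her at most 6.
  refine Restricts.bob_first (Restricts.alice_turn (n + 3) ?_ (by push_cast; omega) ?_)
  · rw [hz _ (by omega)]
    refine Restricts.bob_first (Restricts.alice_turn (n + 3) ?_ (by push_cast; omega) ?_)
    · rw [hz _ (by omega)]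
      refine restricts_odd hn ho (y := n + 4) ⟨k + 5, by ring⟩ (by omega) (by push_cast; omega) (by omega) ?_
      unfold oddSum
      simp (disch := omega) only [step_of_lt, step_of_le]
      norm_num
    · rw [hz _ (by omega)]
      refine restricts_odd hn ho (y := n + 3) ⟨k + 5, by ring⟩ (by omega) (by push_cast; omega) (by omega) ?_
      unfold oddSum
      simp (disch := omega) only [step_of_lt, step_of_le]
      norm_num
  · rw [hz _ (by omega)]
    refine Restricts.bob_last (Restricts.alice_turn (n + 1) ?_ (by push_cast; omega) ?_)
    · rw [hz _ (by omega)]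
      refine restricts_odd hn ho (y := n + 2) ⟨k + 5, by ring⟩ (by omega) (by push_cast; omega) (by omega) ?_
      unfold oddSum
      simp (disch := omega) only [step_of_lt, step_of_le]
      norm_num
    · rw [hz _ (by omega)]
      refine restricts_odd hn ho (y := n + 1) ⟨k + 5, by ring⟩ (by omega) (by push_cast; omega) (by omega) ?_
      unfold oddSum
      simp (disch := omega) only [step_of_lt, step_of_le]
      norm_num

/-- Alice starts at slice `7`. -/
theorem restricts_start_seven {n : ℕ} (hn : 15 ≤ n) (ho : Odd n) :
    Restricts (hardSize n) (n - 1) false 8 5 := by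
  obtain ⟨k, hk⟩ : ∃ k, n = 2 * k + 15 := ⟨(n - 15) / 2, by obtain ⟨t, ht⟩ := ho; omega⟩
  have hz : ∀ i : ℤ, i = 8 ∨ i = 10 ∨ i = n + 5 ∨ i = n + 3 → hardSize n i = 0 := by
    intro i hi
    refine hardSize_eq_zero hn (by omega) (by omega) ?_
    simp only [List.mem_cons, List.not_mem_nil, or_false, forall_eq_or_imp, forall_eq]
    omega
  rw [show n - 1 = 2 * k + 14 by omega]
  -- Bob takes the zero slice 6. If Alice takes 8 he takes 9; if she takes 5 he takes 4. The odd
  -- class then leaves her at most 5.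
  refine Restricts.bob_last (Restricts.alice_turn (n + 5) ?_ (by push_cast; omega) ?_)
  · rw [hz _ (by omega)]
    refine Restricts.bob_first (Restricts.alice_turn (n + 5) ?_ (by push_cast; omega) ?_)
    · rw [hz _ (by omega)]
      refine restricts_odd hn ho (y := n + 6) ⟨k + 5, by ring⟩ (by omega) (by push_cast; omega) (by omega) ?_
      unfold oddSum
      simp (disch := omega) only [step_of_lt, step_of_le]
      norm_num
    · rw [hz _ (by omega)]
      refine restricts_odd hn ho (y := n + 5) ⟨k + 5, by ring⟩ (by omega) (by push_cast; omega) (by omega) ?_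
      unfold oddSum
      simp (disch := omega) only [step_of_lt, step_of_le]
      norm_num
  · rw [hz _ (by omega)]
    refine Restricts.bob_last (Restricts.alice_turn (n + 3) ?_ (by push_cast; omega) ?_)
    · rw [hz _ (by omega)]
      refine restricts_odd hn ho (y := n + 4) ⟨k + 5, by ring⟩ (by omega) (by push_cast; omega) (by omega) ?_
      unfold oddSum
      simp (disch := omega) only [step_of_lt, step_of_le]
      norm_num
    · rw [hz _ (by omega)]
      refine restricts_odd hn ho (y := n + 3) ⟨k + 5, by ring⟩ (by omega) (by push_cast; omega) (by omega) ?_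
      unfold oddSum
      simp (disch := omega) only [step_of_lt, step_of_le]
      norm_num

/-- After Bob has taken slice `12`, he can also take slices `7` and `9`. -/
theorem restricts_after_twelve {n : ℕ} (hn : 15 ≤ n) (ho : Odd n) {x : ℤ} {r : ℕ} (hr : Even r)
    (hx : 15 ≤ x) (hx' : x ≤ n + 3) (hy : x + (r + 1) = n + 12) (hxe : x % 2 = 0) :
    Restricts (hardSize n) (r + 1) true x 4 := by
  obtain ⟨k, hk⟩ := ho
  have hz : ∀ i : ℤ, i = x ∨ i = n + 11 → hardSize n i = 0 := by
    intro i hi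
    refine hardSize_eq_zero hn (by omega) (by omega) ?_
    simp only [List.mem_cons, List.not_mem_nil, or_false, forall_eq_or_imp, forall_eq]
    omega
  have hnn : ∀ a i, 0 ≤ step a i := by
    intro a i; unfold step; split_ifs <;> norm_num
  refine Restricts.alice_turn (n + 11) ?_ (by omega) ?_
  · rw [hz _ (Or.inl rfl)]
    refine restricts_odd hn ⟨k, hk⟩ (y := n + 12) hr (by omega) (by omega) (by omega) ?_
    have h1 := hnn (n + 2) (x + 1)
    have h2 := hnn (n + 4) (x + 1)
    unfold oddSum
    rw [step_of_lt (a := 7) (i := x + 1) (by omega), step_of_lt (a := 9) (i := x + 1) (by omega),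
      step_of_le (a := n + 12) (i := x + 1) (by omega), step_of_le (a := n + 14) (i := x + 1) (by omega)]
    simp (disch := omega) only [step_of_lt (i := n + 12), step_of_le (i := n + 12)]
    linarith
  · rw [hz _ (Or.inr rfl)]
    refine restricts_odd hn ⟨k, hk⟩ (y := n + 11) hr (by omega) (by omega) (by omega) ?_
    have h1 := hnn (n + 2) x
    have h2 := hnn (n + 4) x
    unfold oddSum
    rw [step_of_lt (a := 7) (i := x) (by omega), step_of_lt (a := 9) (i := x) (by omega),
      step_of_le (a := n + 12) (i := x) (by omega), step_of_le (a := n + 14) (i := x) (by omega)]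
    simp (disch := omega) only [step_of_lt (i := n + 11), step_of_le (i := n + 11)]
    linarith

/-- Bob's play after Alice has started at slice `14`; the slices `[x, n + 14)` remain on Alice's turn. -/
theorem restricts_zeros_then_two {n : ℕ} (hn : 15 ≤ n) (ho : Odd n) : ∀ (s : ℕ) (x : ℤ),
    x + 2 * s = n + 1 → 15 ≤ x → Restricts (hardSize n) (2 * s + 12 + 1) true x 4 := by
  have ho' := ho
  obtain ⟨k, hk⟩ := ho
  have hz : ∀ i : ℤ, 0 ≤ i → (15 ≤ i ∧ i ≤ n + 1) ∨ i = n + 3 ∨ i = n + 5 ∨ i = n + 13 →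
      hardSize n i = 0 := by
    intro i h0 hi
    refine hardSize_eq_zero hn (by omega) (by omega) ?_
    simp only [List.mem_cons, List.not_mem_nil, or_false, forall_eq_or_imp, forall_eq]
    omega
  intro s
  induction s with
  | zero =>
    intro x hx hx'
    -- The run of zeros is used up. While Alice stays at the front, Bob takes 2 and then 4, after
    -- which the odd class leaves her only 12 of the positive slices; if she takes 13 earlier, he
    -- answers with 12.
    obtain rfl : x = n + 1 := by push_cast at hx; omega
    refine Restricts.alice_turn (n + 13) ?_ (by push_cast; ring) ?_
    · rw [hz _ (by omega) (by omega)]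
      refine Restricts.bob_first ?_
      refine Restricts.alice_turn (n + 13) ?_ (by push_cast; ring) ?_
      · rw [hz _ (by omega) (by omega)]
        refine Restricts.bob_first (Restricts.alice_turn (n + 13) ?_ (by push_cast; ring) ?_)
        · rw [hz _ (by omega) (by omega)]
          refine restricts_odd hn ho' (y := n + 14) ⟨4, rfl⟩ (by omega) (by push_cast; ring) (by omega) ?_
          unfold oddSum
          simp (disch := omega) only [step_of_lt, step_of_le]
          norm_num
        · rw [hz _ (by omega) (by omega)]
          refine restricts_odd hn ho' (y := n + 13) ⟨4, rfl⟩ (by omega) (by push_cast; ring) (by omega) ?_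
          unfold oddSum
          simp (disch := omega) only [step_of_lt, step_of_le]
          norm_num
      · rw [hz _ (by omega) (by omega), sub_zero, sub_zero]
        exact Restricts.bob_last (restricts_after_twelve hn ho' (r := 8) ⟨4, rfl⟩ (by omega) (by omega)
          (by push_cast; ring) (by omega))
    · rw [hz _ (by omega) (by omega), sub_zero]
      exact Restricts.bob_last (restricts_after_twelve hn ho' (r := 10) ⟨5, rfl⟩ (by omega) (by omega)
        (by push_cast; ring) (by omega))
  | succ s ih =>
    intro x hx hx'
    push_cast at hx
    -- Bob waits in the run of zeros until Alice uncovers slice 12 by taking 13.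
    refine Restricts.alice_turn (n + 13) ?_ (by push_cast; omega) ?_
    · rw [hz _ (by omega) (by omega), sub_zero]
      refine Restricts.bob_first ?_
      exact ih _ (by omega) (by omega)
    · rw [hz _ (by omega) (by omega), sub_zero]
      exact Restricts.bob_last (restricts_after_twelve hn ho' (r := 2 * (s + 1) + 10) ⟨s + 6, by ring⟩
        (by omega) (by omega) (by push_cast; omega) (by omega))

/-- The target 8 is 4/9 of 18. The even class suffices for starts 5, 6 and from 15 on, the odd class
for the others except 4, 7 and 14, where neither does. -/
theorem restricts_hardSize {n : ℕ} (hn : 15 ≤ n) (ho : Odd n) {v : ℕ} (hv : v < n) :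
    Restricts (hardSize n) (n - 1) false (v + 1) (8 - hardSize n v) := by
  have hev : Even (n - 1) := Nat.Odd.sub_odd ho odd_one
  have ho' := ho
  obtain ⟨k, hk⟩ := ho
  rcases lt_or_ge v 15 with h15 | h15
  · rw [hardSize_eq hn (by omega) (by omega)]
    simp (disch := omega) only [if_neg (show ¬ (v : ℤ) = n + 2 by omega),
      if_neg (show ¬ (v : ℤ) = n + 4 by omega), if_neg (show ¬ (v : ℤ) = n + 7 by omega),
      if_neg (show ¬ (v : ℤ) = n + 9 by omega), if_neg (show ¬ (v : ℤ) = n + 12 by omega),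
      if_neg (show ¬ (v : ℤ) = n + 14 by omega)]
    have h := fun c => restricts_odd hn ho' (x := v + 1) (y := n + v) (r := n - 1) (c := c) hev (by omega)
      (by omega) (by omega)
    have h' := fun c => restricts_even hn ho' (x := v + 1) (y := n + v) (r := n - 1) (c := c) hev
      (by omega) (by omega) (by omega)
    by_cases h4 : v = 4
    · subst h4; norm_num; exact restricts_start_four hn ho'
    by_cases h7 : v = 7
    · subst h7; norm_num; exact restricts_start_seven hn ho'
    by_cases h14 : v = 14
    · subst h14
      norm_num
      rw [show n - 1 = 2 * (k - 7) + 12 + 1 + 1 by omega]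
      exact Restricts.bob_first (restricts_zeros_then_two hn ho' _ _ (by omega) (by omega))
    by_cases h56 : v = 5 ∨ v = 6
    · refine h' _ ?_
      unfold evenSum
      rcases h56 with rfl | rfl <;> simp (disch := omega) only [step_of_lt, step_of_le] <;> norm_num
    · refine h _ ?_
      unfold oddSum
      interval_cases v <;> simp (disch := omega) only [step_of_lt, step_of_le] <;> norm_num at *
  · rw [hardSize_eq_zero hn (by omega) (by omega) (by
      simp only [List.mem_cons, List.not_mem_nil, or_false, forall_eq_or_imp, forall_eq]
      omega)]
    refine restricts_even hn ho' (y := n + v) hev (by omega) (by omega) (by omega) ?_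
    unfold evenSum
    rw [step_of_lt (a := 2) (i := v + 1) (by omega), step_of_lt (a := 4) (i := v + 1) (by omega),
      step_of_lt (a := 12) (i := v + 1) (by omega), step_of_lt (a := 14) (i := v + 1) (by omega),
      step_of_le (a := n + 7) (i := v + 1) (by omega), step_of_le (a := n + 9) (i := v + 1) (by omega)]
    simp (disch := omega) only [step_of_lt (i := n + v)]
    norm_num

end Pizza

/-! ### The cutting `1, 1, 0, …` and the conclusion -/

namespace Pizza

theorem restricts_of_zero {w : ℤ → ℝ} : ∀ (r : ℕ) (a : Bool) (x : ℤ) (c : ℝ),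
    (∀ i, x ≤ i → i < x + r → w i = 0) → 0 ≤ c → Restricts w r a x c := by
  intro r
  induction r with
  | zero => intro a x c _ h; cases a <;> exact h
  | succ r ih =>
    intro a x c hz h
    push_cast at hz
    cases a with
    | true =>
      refine Restricts.alice_turn (x + r) (ih _ _ _ (fun i h1 h2 => hz i (by omega) (by omega)) ?_) rfl
        (ih _ _ _ (fun i h1 h2 => hz i (by omega) (by omega)) ?_)
      · rw [hz x (by omega) (by omega)]; linarith
      · rw [hz (x + r) (by omega) (by omega)]; linarith
    | false => exact Restricts.bob_first (ih _ _ _ (fun i h1 h2 => hz i (by omega) (by omega)) h)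

theorem restricts_of_single {w : ℤ → ℝ} (j : ℤ) {c : ℝ} (hc : 0 ≤ c) (hj : w j ≤ c) :
    ∀ (r : ℕ) (a : Bool) (x : ℤ), (∀ i, x ≤ i → i < x + r → i ≠ j → w i = 0) →
      Restricts w r a x c := by
  intro r
  induction r with
  | zero => intro a x _; cases a <;> exact hc
  | succ r ih =>
    intro a x hz
    push_cast at hz
    cases a with
    | true =>
      refine Restricts.alice_turn (x + r) ?_ rfl ?_
      · by_cases hx : x = j
        · exact restricts_of_zero _ _ _ _ (fun i h1 h2 => hz i (by omega) (by omega) (by omega))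
            (by rw [hx]; linarith)
        · rw [hz x (by omega) (by omega) hx, sub_zero]
          exact ih _ _ (fun i h1 h2 h3 => hz i (by omega) (by omega) h3)
      · by_cases hx : x + r = j
        · exact restricts_of_zero _ _ _ _ (fun i h1 h2 => hz i (by omega) (by omega) (by omega))
            (by rw [hx]; linarith)
        · rw [hz (x + r) (by omega) (by omega) hx, sub_zero]
          exact ih _ _ (fun i h1 h2 h3 => hz i (by omega) (by omega) h3)
    | false => exact Restricts.bob_first (ih _ _ (fun i h1 h2 h3 => hz i (by omega) (by omega) h3))

/-- Bob gets one of two adjacent slices of size one. -/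
theorem restricts_of_adjacent_pair {w : ℤ → ℝ} {j : ℤ} (h1 : w j = 1) (h2 : w (j + 1) = 1) :
    ∀ (r : ℕ) (a : Bool) (x : ℤ), x ≤ j → j + 2 ≤ x + r →
      (∀ i, x ≤ i → i < x + r → i ≠ j → i ≠ j + 1 → w i = 0) → Restricts w r a x 1 := by
  intro r
  induction r with
  | zero => intro a x hx hx'; push_cast at hx'; omega
  | succ r ih =>
    intro a x hx hx' hz
    obtain ⟨r, rfl⟩ : ∃ s, r = s + 1 := ⟨r - 1, by omega⟩
    push_cast at hz hx'
    cases a with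
    | true =>
      refine Restricts.alice_turn (x + r + 1) ?_ (by push_cast; ring) ?_
      · by_cases hxj : x = j
        -- Alice has taken one of the pair, and Bob at once takes the other.
        · refine Restricts.bob_first (restricts_of_zero _ _ _ _
            (fun i h1 h2 => hz i (by omega) (by omega) (by omega) (by omega)) ?_)
          rw [hxj]; linarith
        · rw [hz x (by omega) (by omega) hxj (by omega), sub_zero]
          exact ih _ _ (by omega) (by push_cast; omega)
            (fun i h1 h2 h3 h4 => hz i (by omega) (by push_cast at h2; omega) h3 h4)
      · by_cases hxj : x + r + 1 = j + 1
        · refine Restricts.bob_last (restricts_of_zero _ _ _ _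
            (fun i h1 h2 => hz i (by omega) (by omega) (by omega) (by omega)) ?_)
          rw [hxj]; linarith
        · rw [hz (x + r + 1) (by omega) (by omega) (by omega) hxj, sub_zero]
          exact ih _ _ (by omega) (by push_cast; omega)
            (fun i h1 h2 h3 h4 => hz i (by omega) (by push_cast at h2; omega) h3 h4)
    | false =>
      refine Restricts.bob_first ?_
      by_cases hxj : x = j
      · refine restricts_of_single (j + 1) zero_le_one h2.le _ _ _
          (fun i h1 h2 h3 => hz i (by omega) (by push_cast at h2; omega) (by omega) h3)
      · exact ih _ _ (by omega) (by push_cast; omega)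
            (fun i h1 h2 h3 h4 => hz i (by omega) (by push_cast at h2; omega) h3 h4)

theorem restricts_pair {n : ℕ} (hn : 2 ≤ n) {v : ℕ} (hv : v < n) :
    Restricts (fun i => cutting n [1, 1] (i : ZMod n)) (n - 1) false (v + 1)
      (1 - cutting n [1, 1] (v : ZMod n)) := by
  have hw : ∀ (i : ℤ) (t : ℕ), t < n → (i = t ∨ i = n + t) →
      cutting n [1, 1] (i : ZMod n) = [1, 1].getD t (0 : ℝ) := by
    intro i t ht hi
    refine cutting_intCast ht ?_
    rcases hi with rfl | rfl <;> simp
  have hz : ∀ i : ℤ, (2 ≤ i ∧ i < n) ∨ (n + 2 ≤ i ∧ i < n + n) →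
      cutting n [1, 1] (i : ZMod n) = 0 := by
    rintro i (hi | hi)
    · rw [hw i i.toNat (by omega) (by omega)]
      exact List.getD_eq_default _ _ (by simp; omega)
    · rw [hw i (i - n).toNat (by omega) (by omega)]
      exact List.getD_eq_default _ _ (by simp; omega)
  have hv0 := hw v v hv (Or.inl rfl)
  rw [Int.cast_natCast] at hv0
  rw [hv0]
  obtain ⟨r, hr⟩ : ∃ r, n = r + 2 := ⟨n - 2, by omega⟩
  rw [show n - 1 = r + 1 by omega]
  rcases Nat.lt_or_ge v 2 with h2 | h2
  · interval_cases v
    · refine Restricts.bob_first (restricts_of_zero _ _ _ _ (fun i h1 h2 => hz i ?_) (by simp))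
      push_cast at *; omega
    · refine Restricts.bob_last (restricts_of_zero _ _ _ _ (fun i h1 h2 => hz i ?_) (by simp))
      push_cast at *; omega
  · rw [List.getD_eq_default _ _ (by simpa using h2), sub_zero]
    refine restricts_of_adjacent_pair (j := n) ?_ ?_ _ _ _ (by omega) (by push_cast; omega) ?_
    · simpa using hw n 0 (by omega) (by simp)
    · simpa using hw (n + 1) 1 (by omega) (by simp)
    · intro i h1 h2 h3 h4
      refine hz i ?_
      push_cast at *; omega

/-- The value of `g n`. -/
noncomputable def gValue (n : ℕ) : ℝ :=
  if n = 1 then 1 else if Odd n ∧ 15 ≤ n then 4 / 9 else 1 / 2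

theorem exists_zero_jump_strategy {n : ℕ} [NeZero n] (hn : Even n ∨ n ≤ 7) {p : ZMod n → ℝ}
    (hp : ∀ i, 0 ≤ p i) :
    ∃ σ : AliceStrategy n, IsJumpStrategy 0 σ ∧ HasGain σ p (gValue n * size p) := by
  have hnp := Nat.pos_of_ne_zero (NeZero.ne n)
  rcases Nat.even_or_odd n with he | ho
  · have h1 : n ≠ 1 := by rintro rfl; simp at he
    rw [gValue, if_neg h1, if_neg fun h => Nat.not_even_iff_odd.2 h.1 he]
    exact exists_strategy_of_even he p
  · have h7 : n ≤ 7 := hn.resolve_left (Nat.not_even_iff_odd.2 ho)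
    obtain ⟨k, hk⟩ := ho
    have hM : (n : ℤ) = 2 * ((k : ℤ) + 1) - 1 := by omega
    obtain ⟨S, hS, hS'⟩ := exists_isPrefixSum hM hp
    refine Secures.exists_strategy hM hS' ?_
    -- For a single slice `M = 1`, and a half-circle is the whole cycle.
    by_cases h1 : n = 1
    · rw [gValue, if_pos h1, one_mul]
      refine hS.secures_of_le_half (v := 0) 0 fun i _ _ => ?_
      have := hS.add_period i
      rw [show 2 * ((k : ℤ) + 1) - 1 = k + 1 by omega] at this
      rw [half]
      linarith
    · rw [gValue, if_neg h1, if_neg (by omega), one_div_mul_eq_div]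
      exact hS.secures_half_of_le_four (by omega)

theorem exists_one_jump_strategy {n : ℕ} [NeZero n] (hn : n = 9 ∨ n = 11 ∨ n = 13) {p : ZMod n → ℝ}
    (hp : ∀ i, 0 ≤ p i) :
    ∃ σ : AliceStrategy n, IsJumpStrategy 1 σ ∧ HasGain σ p (gValue n * size p) := by
  obtain ⟨k, hk⟩ : Odd n := by rcases hn with rfl | rfl | rfl <;> decide
  have hM : (n : ℤ) = 2 * ((k : ℤ) + 1) - 1 := by omega
  obtain ⟨S, hS, hS'⟩ := exists_isPrefixSum hM hp
  refine Secures.exists_strategy hM hS' ?_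
  rw [gValue, if_neg (by omega), if_neg (by omega), one_div_mul_eq_div]
  exact hS.secures_half_of_le_seven (by omega)

theorem exists_two_jump_strategy {n : ℕ} [NeZero n] (hn : Odd n ∧ 15 ≤ n) {p : ZMod n → ℝ}
    (hp : ∀ i, 0 ≤ p i) :
    ∃ σ : AliceStrategy n, IsJumpStrategy 2 σ ∧ HasGain σ p (gValue n * size p) := by
  obtain ⟨k, hk⟩ := hn.1
  have hM : (n : ℤ) = 2 * ((k : ℤ) + 1) - 1 := by omega
  obtain ⟨S, hS, hS'⟩ := exists_isPrefixSum hM hp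
  refine Secures.exists_strategy hM hS' ?_
  rw [gValue, if_neg (by omega), if_pos hn]
  exact hS.secures_four_ninths

theorem le_of_hasGain_hard {n : ℕ} [NeZero n] (hn : Odd n ∧ 15 ≤ n) {σ : AliceStrategy n} {c : ℝ}
    (h : HasGain σ (cutting n [0, 0, 2, 0, 2, 0, 0, 3, 0, 3, 0, 0, 4, 0, 4]) c) :
    c ≤ 4 / 9 * size (cutting n [0, 0, 2, 0, 2, 0, 0, 3, 0, 3, 0, 0, 4, 0, 4]) := by
  rw [size_cutting _ (by simpa using hn.2)]
  refine (h.le_of_restricts (d := 8) fun v hv => ?_).trans (by norm_num)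
  have := restricts_hardSize hn.2 hn.1 hv
  unfold hardSize at this
  simpa only [Int.cast_natCast] using this

theorem le_of_hasGain_pair {n : ℕ} [NeZero n] (hn : 2 ≤ n) {σ : AliceStrategy n} {c : ℝ}
    (h : HasGain σ (cutting n [1, 1]) c) : c ≤ 1 / 2 * size (cutting n [1, 1]) := by
  rw [size_cutting _ (by simpa using hn)]
  exact (h.le_of_restricts (d := 1) fun v hv => restricts_pair hn hv).trans (by norm_num)

theorem cutting_nonneg {n : ℕ} {L : List ℝ} (hL : ∀ x ∈ L, 0 ≤ x) (i : ZMod n) :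
    0 ≤ cutting n L i := by
  rw [cutting]
  rcases lt_or_ge i.val L.length with h | h
  · rw [List.getD_eq_getElem _ _ h]
    exact hL _ (List.getElem_mem h)
  · rw [List.getD_eq_default _ _ h]

theorem isGreatest_gValue (n : ℕ) [NeZero n] : IsGreatest (guaranteedFractions n) (gValue n) := by
  have hnp := Nat.pos_of_ne_zero (NeZero.ne n)
  constructor
  · refine ⟨?_, fun p hp => ?_⟩
    · unfold gValue
      split_ifs <;> norm_num
    · rcases Nat.even_or_odd n with he | ⟨k, hk⟩
      · exact (exists_zero_jump_strategy (Or.inl he) hp).imp fun _ h => h.2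
      · rcases le_or_gt n 7 with h7 | h7
        · exact (exists_zero_jump_strategy (Or.inr h7) hp).imp fun _ h => h.2
        · rcases le_or_gt 15 n with h15 | h15
          · exact (exists_two_jump_strategy ⟨⟨k, hk⟩, h15⟩ hp).imp fun _ h => h.2
          · exact (exists_one_jump_strategy (by omega) hp).imp fun _ h => h.2
  · rintro c ⟨hc, h⟩
    unfold gValue
    split_ifs with h1 h2
    · exact hc.2
    · obtain ⟨σ, hσ⟩ := h (cutting n [0, 0, 2, 0, 2, 0, 0, 3, 0, 3, 0, 0, 4, 0, 4])
        (cutting_nonneg (by simp))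
      have := le_of_hasGain_hard h2 hσ
      rw [size_cutting _ (by simpa using h2.2)] at this
      norm_num at this
      linarith
    · obtain ⟨σ, hσ⟩ := h (cutting n [1, 1]) (cutting_nonneg (by simp))
      have := le_of_hasGain_pair (by omega) hσ
      rw [size_cutting _ (by simp; omega)] at this
      norm_num at this
      linarith

theorem g_eq_gValue (n : ℕ) [NeZero n] : g n = gValue n := (isGreatest_gValue n).csSup_eq

end Pizza

theorem theorem2 (n : ℕ) [NeZero n] :
    -- the maximum that defines `g n` is attained, and its value
    IsGreatest (Pizza.guaranteedFractions n) (Pizza.g n) ∧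
    Pizza.g n = (if n = 1 then 1 else if Odd n ∧ 15 ≤ n then 4 / 9 else 1 / 2) ∧
    -- numbers of jumps that suffice
    ((Even n ∨ n ≤ 7) → ∀ p : ZMod n → ℝ, (∀ i, 0 ≤ p i) →
      ∃ σ : Pizza.AliceStrategy n,
        Pizza.IsJumpStrategy 0 σ ∧ Pizza.HasGain σ p (Pizza.g n * Pizza.size p)) ∧
    ((n = 9 ∨ n = 11 ∨ n = 13) → ∀ p : ZMod n → ℝ, (∀ i, 0 ≤ p i) →
      ∃ σ : Pizza.AliceStrategy n,
        Pizza.IsJumpStrategy 1 σ ∧ Pizza.HasGain σ p (Pizza.g n * Pizza.size p)) ∧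
    ((Odd n ∧ 15 ≤ n) → ∀ p : ZMod n → ℝ, (∀ i, 0 ≤ p i) →
      ∃ σ : Pizza.AliceStrategy n,
        Pizza.IsJumpStrategy 2 σ ∧ Pizza.HasGain σ p (Pizza.g n * Pizza.size p)) ∧
    -- explicit cuttings on which Alice cannot do better
    ((Odd n ∧ 15 ≤ n) → ∀ (σ : Pizza.AliceStrategy n) (c : ℝ),
      Pizza.HasGain σ (Pizza.cutting n [0, 0, 2, 0, 2, 0, 0, 3, 0, 3, 0, 0, 4, 0, 4]) c →
        c ≤ 4 / 9 *
          Pizza.size (Pizza.cutting n [0, 0, 2, 0, 2, 0, 0, 3, 0, 3, 0, 0, 4, 0, 4])) ∧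
    (2 ≤ n → ∀ (σ : Pizza.AliceStrategy n) (c : ℝ),
      Pizza.HasGain σ (Pizza.cutting n [1, 1]) c →
        c ≤ 1 / 2 * Pizza.size (Pizza.cutting n [1, 1])) := by
  rw [Pizza.g_eq_gValue]
  exact ⟨Pizza.isGreatest_gValue n, rfl,
    fun hn _ hp => Pizza.exists_zero_jump_strategy hn hp,
    fun hn _ hp => Pizza.exists_one_jump_strategy hn hp,
    fun hn _ hp => Pizza.exists_two_jump_strategy hn hp,
    fun hn _ _ h => Pizza.le_of_hasGain_hard hn h,
    fun hn _ _ h => Pizza.le_of_hasGain_pair hn h⟩
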